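/- Let $N\ge 1$, $\mathcal T=\{0,1,\dots,N\}$, and let $(\Omega,\mathcal F,(\mathcal F_n)_{n\in\mathcal T},\mathbb P)$ be a filtered probability space. Let $S=(S_n)_{n\in\mathcal T}$ be a real adapted process which is locally square integrable, i.e. $\mathbb E[(\Delta S_n)^2\mid\mathcal F_{n-1}]<\infty$ a.s. for $1\le n\le N$, where $\Delta S_n=S_n-S_{n-1}$. Conditional expectations are understood in the generalized sense $\mathbb E[X\mid\mathcal G]=\mathbb E[X^+\mid\mathcal G]-\mathbb E[X^-\mid\mathcal G]$. Let $H=(H_n)_{n\in\mathcal T}$ be adapted with $H_n\in L^2(\mathbb P)$, let $\tau$ be an $\mathcal F$-measurable random time with values in $\mathcal T$, and let $\omega_n=\mathbb P(\tau=n\mid\mathcal F_n)$. An admissible strategy is any predictable process $\xi=(\xi_n)_{1\le n\le N}$ ($\xi_n$ is $\mathcal F_{n-1}$-measurable, no integrability required); write $\mathcal A$ for the set of these and $G_n(\xi)=\sum_{i=1}^n\xi_i\,\Delta S_i$. Define, by backward recursion for $n=N,\dots,1$ and with $0/0=0$, $\beta_n=\alpha_n/\delta_n$, where $$\alpha_n=\mathbb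 E\Big[\Delta S_n\sum_{i=n}^N\omega_i\prod_{j=n+1}^i(1-\beta_j\Delta S_j)\Big|\mathcal F_{n-1}\Big],\qquad \delta_n=\mathbb E\Big[(\Delta S_n)^2\sum_{i=n}^N\omega_i\prod_{j=n+1}^i(1-\beta_j\Delta S_j)^2\Big|\mathcal F_{n-1}\Big],$$ and put $$Z_n=\omega_n\prod_{i=1}^n(1-\beta_i\Delta S_i),\qquad c^\star=\frac{\sum_{n=0}^N\mathbb E(Z_nH_n)}{\sum_{n=0}^N\mathbb E(Z_n)}\qquad(0/0=0).$$ Then $Z_n$ and $Z_nH_n$ are integrable, and $c^\star$ solves the pricing problem under random horizon $$\min_{c\in\mathbb R}\ \min_{\xi\in\mathcal A}\ \mathbb E\big[(H_\tau-c-G_\tau(\xi))^2\big]:$$ for every $c\in\mathbb R$ the inner minimum $W(c)$ over $\xi\in\mathcal A$ (of expectations with values in $[0,\infty]$) is attained, and $W(c^\star)\le W(c)$ for all $c\in\mathbb R$. If in addition $\tau$ is independent of $\mathcal F_N$ (for instance, if $\tau$ is independent of $S$ and $(\mathcal F_n)$ is the filtration generated by $S$) and $S$ is an $(\mathcal F_n)$-martingale,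 then $$c^\star=\sum_{n=0}^N\mathbb E(H_n)\,\mathbb P(\tau=n).$$ -/

import Mathlib

open MeasureTheory ProbabilityTheory Finset
open scoped ENNReal

noncomputable section

namespace QuadHedge

variable {Ω : Type*} {mΩ : MeasurableSpace Ω}

/-- The (generalized) conditional expectation `E[X⁺ | m] - E[X⁻ | m]` of a real random variable,
meaningful as soon as `E[|X| | m]` is finite almost surely; `X` need not be integrable. For integrable
`X` it is the usual conditional expectation, see `genCondExp_ae_eq_condExp`. -/
def genCondExp (m : MeasurableSpace Ω) (μ : Measure[mΩ] Ω) (X : Ω → ℝ) (x : Ω) : ℝ :=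
  (condLExp m μ (fun y => ENNReal.ofReal (X y)) x).toReal
    - (condLExp m μ (fun y => ENNReal.ofReal (-X y)) x).toReal

/-- For an integrable random variable this is the usual conditional expectation. -/
theorem genCondExp_ae_eq_condExp (m : MeasurableSpace Ω) (μ : Measure[mΩ] Ω) (X : Ω → ℝ)
    (hX : Integrable X μ) : genCondExp m μ X =ᵐ[μ] μ[X | m] := by
  have key : ∀ Y : Ω → ℝ, Integrable Y μ → Integrable (fun x => (ENNReal.ofReal (Y x)).toReal) μ ∧
      (fun x => (condLExp m μ (fun y => ENNReal.ofReal (Y y)) x).toReal)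
        =ᵐ[μ] μ[fun x => (ENNReal.ofReal (Y x)).toReal | m] := by
    intro Y hY
    have hfin : ∫⁻ x, ENNReal.ofReal (Y x) ∂μ ≠ ∞ := hY.lintegral_lt_top.ne
    exact ⟨integrable_toReal_of_lintegral_ne_top hY.1.aemeasurable.ennreal_ofReal hfin,
      toReal_condLExp m hY.1.aemeasurable.ennreal_ofReal hfin⟩
  obtain ⟨i1, h1⟩ := key X hX
  obtain ⟨i2, h2⟩ := key (fun x => -X x) hX.neg
  have hsub := condExp_sub i1 i2 m
  have hXe : (fun x => (ENNReal.ofReal (X x)).toReal) - (fun x => (ENNReal.ofReal (-X x)).toReal)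
      = X := by
    funext x
    simp only [Pi.sub_apply, ENNReal.toReal_ofReal']
    exact max_zero_sub_max_neg_zero_eq_self (X x)
  rw [hXe] at hsub
  filter_upwards [h1, h2, hsub] with x a b c
  rw [c, Pi.sub_apply, ← a, ← b]
  rfl

/-- The increment `ΔS_n = S_n - S_{n-1}` (so that `ΔS_0 = 0`). -/
def incr (S : ℕ → Ω → ℝ) (n : ℕ) (x : Ω) : ℝ := S n x - S (n - 1) x

/-- `S_0, …, S_N` is adapted and locally square integrable:
`E[(ΔS_n)² | F_{n-1}] < ∞` almost surely for `1 ≤ n ≤ N`. -/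
structure IsPriceProcess (N : ℕ) (ℱ : Filtration ℕ mΩ) (μ : Measure Ω) (S : ℕ → Ω → ℝ) : Prop where
  adapted : ∀ n ≤ N, StronglyMeasurable[ℱ n] (S n)
  locallySquareIntegrable : ∀ n ∈ Icc 1 N, ∀ᵐ x ∂μ,
    condLExp (ℱ (n - 1)) μ (fun y => ENNReal.ofReal (incr S n y ^ 2)) x < ∞

/-- Admissible strategies: all predictable processes `ξ_1, …, ξ_N`. -/
def admissible (N : ℕ) (ℱ : Filtration ℕ mΩ) : Set (ℕ → Ω → ℝ) :=
  {ξ | ∀ n ∈ Icc 1 N, StronglyMeasurable[ℱ (n - 1)] (ξ n)}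

/-- The gain process `G_n(ξ) = ∑_{i=1}^n ξ_i ΔS_i`. -/
def gain (S ξ : ℕ → Ω → ℝ) (n : ℕ) (x : Ω) : ℝ := ∑ i ∈ Icc 1 n, ξ i x * incr S i x

/-- `E[(H_τ - c - G_τ(ξ))²]`, with values in `[0, ∞]`. -/
def hedgingError (μ : Measure Ω) (S H : ℕ → Ω → ℝ) (τ : Ω → ℕ) (c : ℝ) (ξ : ℕ → Ω → ℝ) : ℝ≥0∞ :=
  ∫⁻ x, ENNReal.ofReal ((H (τ x) x - c - gain S ξ (τ x) x) ^ 2) ∂μ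

/-- `α_n`, computed from the values `b_j`, `j > n`, of the process `β`. -/
def alphaOf (N : ℕ) (ℱ : Filtration ℕ mΩ) (μ : Measure Ω) (S ω b : ℕ → Ω → ℝ) (n : ℕ) : Ω → ℝ :=
  genCondExp (ℱ (n - 1)) μ fun x =>
    incr S n x * ∑ i ∈ Icc n N, ω i x * ∏ j ∈ Ioc n i, (1 - b j x * incr S j x)

/-- `δ_n`, computed from the values `b_j`, `j > n`, of the process `β`. -/
def deltaOf (N : ℕ) (ℱ : Filtration ℕ mΩ) (μ : Measure Ω) (S ω b : ℕ → Ω → ℝ) (n : ℕ) : Ω → ℝ :=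
  genCondExp (ℱ (n - 1)) μ fun x =>
    incr S n x ^ 2 * ∑ i ∈ Icc n N, ω i x * ∏ j ∈ Ioc n i, (1 - b j x * incr S j x) ^ 2

/-- The first `k` steps of the backward recursion for `β`: the entries `N, N - 1, …, N - k + 1` hold
`β_N, …, β_{N-k+1}`, all others are zero. -/
def betaAux (N : ℕ) (ℱ : Filtration ℕ mΩ) (μ : Measure Ω) (S ω : ℕ → Ω → ℝ) : ℕ → ℕ → Ω → ℝ
  | 0 => 0
  | k + 1 => Function.update (betaAux N ℱ μ S ω k) (N - k)
      (alphaOf N ℱ μ S ω (betaAux N ℱ μ S ω k) (N - k)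
        / deltaOf N ℱ μ S ω (betaAux N ℱ μ S ω k) (N - k))

/-- The process `β_n = α_n / δ_n`, `1 ≤ n ≤ N` (with `0 / 0 = 0`), defined by backward recursion;
see `beta_eq`. -/
def beta (N : ℕ) (ℱ : Filtration ℕ mΩ) (μ : Measure Ω) (S ω : ℕ → Ω → ℝ) : ℕ → Ω → ℝ :=
  betaAux N ℱ μ S ω N

/-- `Z_n = ω_n ∏_{i=1}^n (1 - β_i ΔS_i)`. -/
def Zproc (N : ℕ) (ℱ : Filtration ℕ mΩ) (μ : Measure Ω) (S ω : ℕ → Ω → ℝ) (n : ℕ) (x : Ω) : ℝ :=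
  ω n x * ∏ i ∈ Icc 1 n, (1 - beta N ℱ μ S ω i x * incr S i x)

/-- `c⋆ = ∑ E(Z_n H_n) / ∑ E(Z_n)`, sums over `0 ≤ n ≤ N` (with `0 / 0 = 0`). -/
def cStar (N : ℕ) (ℱ : Filtration ℕ mΩ) (μ : Measure Ω) (S ω H : ℕ → Ω → ℝ) : ℝ :=
  (∑ n ∈ range (N + 1), ∫ x, Zproc N ℱ μ S ω n x * H n x ∂μ)
    / ∑ n ∈ range (N + 1), ∫ x, Zproc N ℱ μ S ω n x ∂μ

lemma alphaOf_congr {N : ℕ} {ℱ : Filtration ℕ mΩ} {μ : Measure Ω} {S ω b b' : ℕ → Ω → ℝ} {n : ℕ}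
    (h : ∀ j, n < j → j ≤ N → b j = b' j) :
    alphaOf N ℱ μ S ω b n = alphaOf N ℱ μ S ω b' n := by
  unfold alphaOf
  congr 1
  funext x
  congr 1
  refine sum_congr rfl fun i hi => ?_
  congr 1
  refine prod_congr rfl fun j hj => ?_
  rw [h j (mem_Ioc.1 hj).1 ((mem_Ioc.1 hj).2.trans (mem_Icc.1 hi).2)]

lemma deltaOf_congr {N : ℕ} {ℱ : Filtration ℕ mΩ} {μ : Measure Ω} {S ω b b' : ℕ → Ω → ℝ} {n : ℕ}
    (h : ∀ j, n < j → j ≤ N → b j = b' j) :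
    deltaOf N ℱ μ S ω b n = deltaOf N ℱ μ S ω b' n := by
  unfold deltaOf
  congr 1
  funext x
  congr 1
  refine sum_congr rfl fun i hi => ?_
  congr 1
  refine prod_congr rfl fun j hj => ?_
  rw [h j (mem_Ioc.1 hj).1 ((mem_Ioc.1 hj).2.trans (mem_Icc.1 hi).2)]

lemma betaAux_stable {N : ℕ} {ℱ : Filtration ℕ mΩ} {μ : Measure Ω} {S ω : ℕ → Ω → ℝ} (k l : ℕ)
    (hl : k + l ≤ N) (j : ℕ) (hj : N - k < j) :
    betaAux N ℱ μ S ω (k + l) j = betaAux N ℱ μ S ω k j := by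
  induction l with
  | zero => rfl
  | succ l ih =>
    rw [← add_assoc, betaAux, Function.update_of_ne (by omega)]
    exact ih (by omega)

/-- The defining equation `β_n = α_n / δ_n` for `1 ≤ n ≤ N`. -/
theorem beta_eq (N : ℕ) (ℱ : Filtration ℕ mΩ) (μ : Measure Ω) (S ω : ℕ → Ω → ℝ) (n : ℕ)
    (hn : n ∈ Icc 1 N) :
    beta N ℱ μ S ω n =
      alphaOf N ℱ μ S ω (beta N ℱ μ S ω) n / deltaOf N ℱ μ S ω (beta N ℱ μ S ω) n := by
  obtain ⟨h1, h2⟩ := mem_Icc.1 hn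
  have hst : ∀ k ≤ N, ∀ j, N - k < j → beta N ℱ μ S ω j = betaAux N ℱ μ S ω k j := by
    intro k hk j hj
    obtain ⟨l, rfl⟩ := Nat.exists_eq_add_of_le hk
    exact betaAux_stable k l le_rfl j hj
  have hk : N - (N - n) = n := by omega
  rw [alphaOf_congr (b' := betaAux N ℱ μ S ω (N - n)) fun j hj _ => hst _ (by omega) j (by omega),
    deltaOf_congr (b' := betaAux N ℱ μ S ω (N - n)) fun j hj _ => hst _ (by omega) j (by omega),
    hst (N - n + 1) (by omega) n (by omega), betaAux, hk, Function.update_self]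

end QuadHedge

end

/-! Conditioning on `ℱ i` replaces the event `τ = i` by the weight `ω i`, so the hedging error is
the expectation of `∑ ω_i (H_i - c - G_i)²` (`hedgingError_eq`). This is a linear-quadratic control
problem with the wealth as state, solved by dynamic programming: the optimal cost from time `n` on
at wealth `g` is the expectation of a random quadratic `a g² - 2 b g + c` with `ℱ n`-measurable
coefficients (`exists_costToGo`).

In one step (`exists_dynamic_programming_step`), with `X` the next increment, the conditional
expectation of `a (g + ξ X)² - 2 b (g + ξ X) + c` is quadratic in `(g, ξ)`. Completing the square in
`ξ` gives the optimum `ξ = κ/δ - g β`, where `β = α/δ` and `κ` is the conditional expectation of `X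
b`. The new `a` and `b` are, up to the running term, the conditional expectations of `(1 - β X) a`
and `(1 - β X) b`. Iterated, they become those of the tail sums of `ω_i ∏ (1 - β_j ΔS_j)` without
and with the factor `H_i`. At time 0 the value is thus a quadratic in the initial capital with
coefficients `∑ E(Z_n)` and `∑ E(Z_n H_n)`, and `c⋆` is its vertex.

The difficulty is integrability, as `β`, `ξ` and `S` carry no moment bounds. Conditional
expectations are localized by positive weights (`IsGenCondExp`), and costs are compared in `[0, ∞]`.
Moreover `a` is also the conditional expectation of the tail sum with squared factors, and it stays
bounded: each step subtracts `β α ≥ 0` and adds `ω ≤ 1`. So the squared tail sums are integrable,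
and they dominate the signed ones. -/

noncomputable section

namespace QuadHedge

/-! ### Generalized conditional expectations -/

section GenCondExp

variable {Ω : Type*} {m m₁ m₂ mΩ : MeasurableSpace Ω} {μ : Measure[mΩ] Ω} {X X' Y Y' Z f w : Ω → ℝ}

/-- The densities `condLExp m μ F` and `F` give measures that agree on `m`, hence integrate every
`m`-measurable function alike, finite or not. -/
lemma lintegral_mul_condLExp [IsFiniteMeasure μ] (hm : m ≤ mΩ) {u F : Ω → ℝ≥0∞}
    (hu : Measurable[m] u) (hF : AEMeasurable F μ) :
    ∫⁻ x, u x * condLExp m μ F x ∂μ = ∫⁻ x, u x * F x ∂μ := by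
  have h : (μ.withDensity (condLExp m μ F)).trim hm = (μ.withDensity F).trim hm := by
    refine @Measure.ext Ω m _ _ fun s hs => ?_
    rw [trim_measurableSet_eq hm hs, trim_measurableSet_eq hm hs, withDensity_apply _ (hm s hs),
      withDensity_apply _ (hm s hs), setLIntegral_condLExp hm μ F hs]
  have hu' : Measurable u := hu.mono hm le_rfl
  have e1 := lintegral_withDensity_eq_lintegral_mul₀ (μ := μ) (measurable_condLExp' m μ F).aemeasurable
    (g := u) hu'.aemeasurable
  have e2 := lintegral_withDensity_eq_lintegral_mul₀ hF (g := u) hu'.aemeasurable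
  rw [← lintegral_trim hm hu, h, lintegral_trim hm hu, e2] at e1
  simpa [mul_comm] using e1.symm

lemma condLExp_mul_left [IsFiniteMeasure μ] (hm : m ≤ mΩ) {u F : Ω → ℝ≥0∞}
    (hu : Measurable[m] u) (hF : AEMeasurable F μ) :
    condLExp m μ (fun x => u x * F x) =ᵐ[μ] fun x => u x * condLExp m μ F x := by
  refine (ae_eq_condLExp hm μ _ (hu.mul (measurable_condLExp m μ F)) fun s hs => ?_).symm
  have := lintegral_mul_condLExp hm (u := s.indicator u) (hu.indicator hs) hF
  rw [← lintegral_indicator (hm s hs), ← lintegral_indicator (hm s hs)]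
  convert this using 3 with x x <;> by_cases hx : x ∈ s <;> simp [hx]

/-- `w` is a positive `m`-measurable weight, at most one, which makes `X` integrable, and `w * Y` is
the conditional expectation of `w * X`. -/
structure IsLocalizing (m : MeasurableSpace Ω) (μ : Measure[mΩ] Ω) (X Y w : Ω → ℝ) : Prop where
  meas : StronglyMeasurable[m] w
  pos : ∀ x, 0 < w x
  le_one : ∀ x, w x ≤ 1
  int : Integrable (fun x => w x * X x) μ
  eq : μ[fun x => w x * X x | m] =ᵐ[μ] fun x => w x * Y x

/-- `Y` is a generalized conditional expectation of `X` given `m`. -/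
def IsGenCondExp (m : MeasurableSpace Ω) (μ : Measure[mΩ] Ω) (X Y : Ω → ℝ) : Prop :=
  ∃ w, IsLocalizing m μ X Y w

lemma condExp_mul_of_abs_le_one [IsFiniteMeasure μ] (hm : m ≤ mΩ)
    (hf : StronglyMeasurable[m] f) (hf1 : ∀ x, |f x| ≤ 1) (hX : Integrable X μ) :
    Integrable (fun x => f x * X x) μ ∧
      μ[fun x => f x * X x | m] =ᵐ[μ] fun x => f x * (μ[X | m]) x :=
  ⟨hX.bdd_mul (hf.mono hm).aestronglyMeasurable (Filter.Eventually.of_forall hf1),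
    condExp_stronglyMeasurable_mul_of_bound hm hf hX 1 (Filter.Eventually.of_forall hf1)⟩

namespace IsLocalizing

lemma abs_le_one (h : IsLocalizing m μ X Y w) (x : Ω) : |w x| ≤ 1 := by
  rw [abs_of_pos (h.pos x)]; exact h.le_one x

lemma mul_weight [IsFiniteMeasure μ] (hm : m ≤ mΩ) (h : IsLocalizing m μ X Y w) {v : Ω → ℝ}
    (hv : StronglyMeasurable[m] v) (hv0 : ∀ x, 0 < v x) (hv1 : ∀ x, v x ≤ 1) :
    IsLocalizing m μ X Y fun x => v x * w x := by
  obtain ⟨hi, he⟩ := condExp_mul_of_abs_le_one hm hv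
    (fun x => by rw [abs_of_pos (hv0 x)]; exact hv1 x) h.int
  refine ⟨hv.mul h.meas, fun x => mul_pos (hv0 x) (h.pos x),
    fun x => mul_le_one₀ (hv1 x) (h.pos x).le (h.le_one x), ?_, ?_⟩
  · simpa only [mul_assoc] using hi
  · simp only [mul_assoc]
    filter_upwards [he, h.eq] with x h1 h2
    rw [h1, h2]

/-- The extra weight turns the unbounded factor `f` into `f / (1 + |f|)`, which is at most one in
absolute value. -/
lemma mul_left [IsFiniteMeasure μ] (hm : m ≤ mΩ) (h : IsLocalizing m μ X Y w)
    (hf : StronglyMeasurable[m] f) :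
    IsLocalizing m μ (fun x => f x * X x) (fun x => f x * Y x) fun x => (1 + |f x|)⁻¹ * w x := by
  have hp : ∀ x, 0 < 1 + |f x| := fun x => by positivity
  have hn : StronglyMeasurable[m] fun x => (1 + |f x|)⁻¹ :=
    (measurable_const.add (continuous_abs.measurable.comp hf.measurable)).inv.stronglyMeasurable
  have hn1 : ∀ x, (1 + |f x|)⁻¹ ≤ 1 := fun x => inv_le_one_of_one_le₀ (by simp)
  obtain ⟨hi, he⟩ := condExp_mul_of_abs_le_one hm (hn.mul hf) (fun x => by
    rw [Pi.mul_apply, abs_mul, abs_of_pos (inv_pos.2 (hp x)), inv_mul_le_iff₀ (hp x)]; linarith) h.int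
  have hr : ∀ x t, ((fun x => (1 + |f x|)⁻¹) * f) x * (w x * t) =
      (1 + |f x|)⁻¹ * w x * (f x * t) := fun x t => by simp only [Pi.mul_apply]; ring
  simp only [hr] at hi he
  refine ⟨hn.mul h.meas, fun x => mul_pos (inv_pos.2 (hp x)) (h.pos x),
    fun x => mul_le_one₀ (hn1 x) (h.pos x).le (h.le_one x), hi, he.trans ?_⟩
  filter_upwards [h.eq] with x h2
  rw [h2, hr]

/-- Pull `w` out of `w (f X)` and `f` out of `f (w X)`; the results agree, and `w > 0` cancels. -/
lemma condExp_eq [IsFiniteMeasure μ] (hm : m ≤ mΩ) (h : IsLocalizing m μ X Y w)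
    (hf : StronglyMeasurable[m] f) (hi : Integrable (fun x => f x * X x) μ) :
    μ[fun x => f x * X x | m] =ᵐ[μ] fun x => f x * Y x := by
  obtain ⟨i1, e1⟩ := condExp_mul_of_abs_le_one hm h.meas h.abs_le_one hi
  have hc : (fun x => w x * (f x * X x)) = f * fun x => w x * X x := by
    funext x; simp only [Pi.mul_apply]; ring
  rw [hc] at i1 e1
  filter_upwards [e1, condExp_mul_of_stronglyMeasurable_left hf i1 h.int, h.eq] with x h1 h2 h3
  rw [h1, Pi.mul_apply, h3] at h2
  have := (h.pos x).ne'
  apply mul_left_cancel₀ this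
  rw [h2]; ring

end IsLocalizing

namespace IsGenCondExp

lemma of_integrable (hX : Integrable X μ) : IsGenCondExp m μ X (μ[X | m]) :=
  ⟨fun _ => 1, stronglyMeasurable_const, fun _ => one_pos, fun _ => le_rfl, by simpa using hX,
    by simp⟩

lemma congr (h : IsGenCondExp m μ X Y) (hX : X =ᵐ[μ] X') (hY : Y =ᵐ[μ] Y') :
    IsGenCondExp m μ X' Y' := by
  obtain ⟨w, h⟩ := h
  have hc : (fun x => w x * X x) =ᵐ[μ] fun x => w x * X' x := by
    filter_upwards [hX] with x hx; rw [hx]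
  refine ⟨w, h.meas, h.pos, h.le_one, h.int.congr hc, (condExp_congr_ae hc).symm.trans (h.eq.trans ?_)⟩
  filter_upwards [hY] with x hx; rw [hx]

lemma congr_left (h : IsGenCondExp m μ X Y) (hX : ∀ x, X x = X' x) : IsGenCondExp m μ X' Y :=
  h.congr (Filter.Eventually.of_forall hX) Filter.EventuallyEq.rfl

lemma nonneg (h : IsGenCondExp m μ X Y) (hX : 0 ≤ᵐ[μ] X) : 0 ≤ᵐ[μ] Y := by
  obtain ⟨w, h⟩ := h
  have : 0 ≤ᵐ[μ] μ[fun x => w x * X x | m] := condExp_nonneg (by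
    filter_upwards [hX] with x hx using mul_nonneg (h.pos x).le hx)
  filter_upwards [this, h.eq] with x h1 h2
  rw [h2] at h1
  exact nonneg_of_mul_nonneg_right h1 (h.pos x)

lemma aestronglyMeasurable (hm : m ≤ mΩ) (h : IsGenCondExp m μ X Y) :
    AEStronglyMeasurable X μ := by
  obtain ⟨w, h⟩ := h
  have hw : Measurable w := (h.meas.mono hm).measurable
  refine (hw.inv.aestronglyMeasurable.mul h.int.1).congr (Filter.Eventually.of_forall fun x => ?_)
  have := (h.pos x).ne'
  simp [this]

variable [IsFiniteMeasure μ]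

lemma mul_left (hm : m ≤ mΩ) (h : IsGenCondExp m μ X Y) (hf : StronglyMeasurable[m] f) :
    IsGenCondExp m μ (fun x => f x * X x) fun x => f x * Y x := by
  obtain ⟨w, h⟩ := h
  exact ⟨_, h.mul_left hm hf⟩

lemma add (hm : m ≤ mΩ) (h : IsGenCondExp m μ X Y) (h' : IsGenCondExp m μ X' Y') :
    IsGenCondExp m μ (fun x => X x + X' x) fun x => Y x + Y' x := by
  obtain ⟨w, h⟩ := h
  obtain ⟨v, h'⟩ := h'
  have h1 := h.mul_weight hm h'.meas h'.pos h'.le_one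
  have h2 := h'.mul_weight hm h.meas h.pos h.le_one
  simp only [mul_comm (w _)] at h2
  refine ⟨_, h1.meas, h1.pos, h1.le_one, ?_, ?_⟩
  · simp only [mul_add]
    exact h1.int.add h2.int
  · have := condExp_add h1.int h2.int m
    simp only [mul_add]
    refine this.trans ?_
    filter_upwards [h1.eq, h2.eq] with x e1 e2
    rw [Pi.add_apply, e1, e2]

lemma neg (hm : m ≤ mΩ) (h : IsGenCondExp m μ X Y) :
    IsGenCondExp m μ (fun x => -X x) fun x => -Y x := by
  simpa using h.mul_left hm (stronglyMeasurable_const (b := (-1 : ℝ)))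

lemma sub (hm : m ≤ mΩ) (h : IsGenCondExp m μ X Y) (h' : IsGenCondExp m μ X' Y') :
    IsGenCondExp m μ (fun x => X x - X' x) fun x => Y x - Y' x := by
  simpa only [sub_eq_add_neg] using h.add hm (h'.neg hm)

lemma of_stronglyMeasurable (hm : m ≤ mΩ) (hf : StronglyMeasurable[m] f) :
    IsGenCondExp m μ f f := by
  have h := (of_integrable (m := m) (integrable_const (μ := μ) (1 : ℝ))).mul_left hm hf
  rw [condExp_const hm] at h
  simpa using h

lemma condExp_eq (hm : m ≤ mΩ) (h : IsGenCondExp m μ X Y) (hX : Integrable X μ) :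
    μ[X | m] =ᵐ[μ] Y := by
  obtain ⟨w, h⟩ := h
  simpa using h.condExp_eq hm (stronglyMeasurable_const (b := (1 : ℝ))) (by simpa using hX)

lemma unique (hm : m ≤ mΩ) (h : IsGenCondExp m μ X Y) (h' : IsGenCondExp m μ X Y') :
    Y =ᵐ[μ] Y' := by
  obtain ⟨w, h⟩ := h
  obtain ⟨v, h'⟩ := h'
  filter_upwards [h'.eq, h.condExp_eq hm h'.meas h'.int] with x h1 h2
  exact mul_left_cancel₀ (h'.pos x).ne' (h2.symm.trans h1)

lemma mono (hm : m ≤ mΩ) (h : IsGenCondExp m μ X Y) (h' : IsGenCondExp m μ X' Y')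
    (hX : X ≤ᵐ[μ] X') : Y ≤ᵐ[μ] Y' := by
  have := (h'.sub hm h).nonneg (by filter_upwards [hX] with x hx using sub_nonneg.2 hx)
  filter_upwards [this] with x hx using sub_nonneg.1 hx

/-- The weight that localizes `X` over `m₁` also localizes `Y`, because `w Y` is the conditional
expectation of the integrable `w X`. No sign condition is needed in this direction. -/
lemma integrable_mul_of_tower (hm₁ : m₁ ≤ m₂) (hm₂ : m₂ ≤ mΩ) (h : IsGenCondExp m₂ μ X Y)
    (hw : IsLocalizing m₁ μ X Z w) : Integrable (fun x => w x * Y x) μ ∧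
      μ[fun x => w x * Y x | m₁] =ᵐ[μ] fun x => w x * Z x := by
  obtain ⟨v, h⟩ := h
  have e := h.condExp_eq hm₂ (hw.meas.mono hm₁) hw.int
  exact ⟨integrable_condExp.congr e, (condExp_congr_ae e).symm.trans
    ((condExp_condExp_of_le hm₁ hm₂).trans hw.eq)⟩

lemma tower (hm₁ : m₁ ≤ m₂) (hm₂ : m₂ ≤ mΩ) (h : IsGenCondExp m₂ μ X Y)
    (h' : IsGenCondExp m₁ μ X Z) : IsGenCondExp m₁ μ Y Z := by
  obtain ⟨w, hw⟩ := h'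
  obtain ⟨hi, he⟩ := integrable_mul_of_tower hm₁ hm₂ h hw
  exact ⟨w, hw.meas, hw.pos, hw.le_one, hi, he⟩

lemma condLExp_ofReal (hm : m ≤ mΩ) (h : IsGenCondExp m μ X Y) (hX : 0 ≤ᵐ[μ] X) :
    condLExp m μ (fun x => ENNReal.ofReal (X x)) =ᵐ[μ] fun x => ENNReal.ofReal (Y x) := by
  have hXm := h.aestronglyMeasurable hm
  obtain ⟨w, h⟩ := h
  have hpull := condLExp_mul_left hm h.meas.measurable.ennreal_ofReal
    hXm.aemeasurable.ennreal_ofReal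
  have hw0 : 0 ≤ᵐ[μ] fun x => w x * X x := by
    filter_upwards [hX] with x hx using mul_nonneg (h.pos x).le hx
  have h2 := MeasureTheory.condLExp_ofReal m h.int hw0
  simp only [ENNReal.ofReal_mul (h.pos _).le] at h2
  filter_upwards [hpull, h2, h.eq] with x a b c
  have hw := h.pos x
  rw [a, c, ENNReal.ofReal_mul hw.le] at b
  exact (ENNReal.mul_right_inj (by simpa using hw) ENNReal.ofReal_ne_top).1 b

/-- An identity in `[0, ∞]`, so infinite expected costs need no separate treatment. -/
lemma lintegral_ofReal (hm : m ≤ mΩ) (h : IsGenCondExp m μ X Y) (hX : 0 ≤ᵐ[μ] X) :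
    ∫⁻ x, ENNReal.ofReal (X x) ∂μ = ∫⁻ x, ENNReal.ofReal (Y x) ∂μ := by
  rw [← lintegral_condLExp hm, lintegral_congr_ae (h.condLExp_ofReal hm hX)]

lemma integrable_of_nonneg (hm : m ≤ mΩ) (h : IsGenCondExp m μ X Y) (hX : 0 ≤ᵐ[μ] X)
    (hY : Integrable Y μ) : Integrable X μ := by
  refine (lintegral_ofReal_ne_top_iff_integrable (h.aestronglyMeasurable hm) hX).1 ?_
  rw [h.lintegral_ofReal hm hX]
  exact hY.lintegral_lt_top.ne

/-- Converse direction to `tower`. Integrability of `w X` has to be recovered from that of `w Y`;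
the sign of `X` makes this possible, since both then have the same integral. -/
lemma trans_of_nonneg (hm₁ : m₁ ≤ m₂) (hm₂ : m₂ ≤ mΩ) (h : IsGenCondExp m₂ μ X Y)
    (h' : IsGenCondExp m₁ μ Y Z) (hX : 0 ≤ᵐ[μ] X) : IsGenCondExp m₁ μ X Z := by
  obtain ⟨w, hw⟩ := h'
  have hi := (h.mul_left hm₂ (hw.meas.mono hm₁)).integrable_of_nonneg hm₂ (by
    filter_upwards [hX] with x hx using mul_nonneg (hw.pos x).le hx) hw.int
  have h3 := (h.mul_left hm₂ (hw.meas.mono hm₁)).condExp_eq hm₂ hi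
  exact ⟨w, hw.meas, hw.pos, hw.le_one, hi, (condExp_condExp_of_le hm₁ hm₂).symm.trans
    ((condExp_congr_ae h3).trans hw.eq)⟩

/-- Bridge to the concrete definition: `w` comes out of the positive and the negative part, and for
`w X` both notions are the usual conditional expectation. -/
lemma genCondExp_eq (hm : m ≤ mΩ) (h : IsGenCondExp m μ X Y) : genCondExp m μ X =ᵐ[μ] Y := by
  have hXm := (h.aestronglyMeasurable hm).aemeasurable
  obtain ⟨w, h⟩ := h
  have h1 := condLExp_mul_left hm h.meas.measurable.ennreal_ofReal hXm.ennreal_ofReal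
  have h2 := condLExp_mul_left hm h.meas.measurable.ennreal_ofReal hXm.neg.ennreal_ofReal
  simp only [← ENNReal.ofReal_mul (h.pos _).le, Pi.neg_apply, mul_neg] at h1 h2
  filter_upwards [h1, h2, genCondExp_ae_eq_condExp m μ _ h.int, h.eq] with x a b c d
  rw [d, genCondExp, a, b, ENNReal.toReal_mul, ENNReal.toReal_mul, ← mul_sub,
    ENNReal.toReal_ofReal (h.pos x).le] at c
  exact mul_left_cancel₀ (h.pos x).ne' c

/-- A weight for the dominating variable also localizes `X`. This is the source of existence for the
signed conditional expectations. -/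
lemma of_abs_le (hm : m ≤ mΩ) (h : IsGenCondExp m μ X' Y') (hX : AEStronglyMeasurable X μ)
    (hle : ∀ᵐ x ∂μ, |X x| ≤ X' x) : IsGenCondExp m μ X (genCondExp m μ X) := by
  obtain ⟨w, h⟩ := h
  have hi : Integrable (fun x => w x * X x) μ := by
    refine h.int.mono' ((h.meas.mono hm).aestronglyMeasurable.mul hX) ?_
    filter_upwards [hle] with x hx
    rw [Real.norm_eq_abs, abs_mul, abs_of_pos (h.pos x)]
    exact mul_le_mul_of_nonneg_left hx (h.pos x).le
  have key : IsGenCondExp m μ X fun x => (w x)⁻¹ * (μ[fun x => w x * X x | m]) x := by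
    refine ⟨w, h.meas, h.pos, h.le_one, hi, Filter.Eventually.of_forall fun x => ?_⟩
    have := (h.pos x).ne'
    simp [this]
  exact key.congr Filter.EventuallyEq.rfl (key.genCondExp_eq hm).symm

end IsGenCondExp

lemma stronglyMeasurable_genCondExp : StronglyMeasurable[m] (genCondExp m μ X) :=
  ((measurable_condLExp m μ _).ennreal_toReal.sub
    (measurable_condLExp m μ _).ennreal_toReal).stronglyMeasurable

lemma genCondExp_congr_ae (h : X =ᵐ[μ] X') : genCondExp m μ X =ᵐ[μ] genCondExp m μ X' := by
  have h1 : (fun y => ENNReal.ofReal (X y)) =ᵐ[μ] fun y => ENNReal.ofReal (X' y) := by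
    filter_upwards [h] with x hx; rw [hx]
  have h2 : (fun y => ENNReal.ofReal (-X y)) =ᵐ[μ] fun y => ENNReal.ofReal (-X' y) := by
    filter_upwards [h] with x hx; rw [hx]
  filter_upwards [condLExp_congr_ae (mΩ := m) h1, condLExp_congr_ae (mΩ := m) h2] with x a b
  rw [genCondExp, a, b, genCondExp]

lemma isGenCondExp_of_condLExp_lt_top [IsFiniteMeasure μ] (hm : m ≤ mΩ)
    (hX : AEStronglyMeasurable X μ) (hX0 : ∀ x, 0 ≤ X x)
    (h : ∀ᵐ x ∂μ, condLExp m μ (fun y => ENNReal.ofReal (X y)) x < ∞) :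
    IsGenCondExp m μ X (genCondExp m μ X) := by
  set s : Ω → ℝ≥0∞ := condLExp m μ fun y => ENNReal.ofReal (X y) with hs
  have hsm : Measurable[m] s := measurable_condLExp m μ _
  -- With this weight, `E[w X] = E[w s] ≤ 1`, because `s / (1 + s) ≤ 1` where `s` is finite.
  set w : Ω → ℝ := fun x => (1 + (s x).toReal)⁻¹ with hw
  have hwm : StronglyMeasurable[m] w :=
    (measurable_const.add hsm.ennreal_toReal).inv.stronglyMeasurable
  have hp : ∀ x, 0 < 1 + (s x).toReal := fun x => by positivity
  have hw0 : ∀ x, 0 < w x := fun x => inv_pos.2 (hp x)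
  have hi : Integrable (fun x => w x * X x) μ := by
    refine (lintegral_ofReal_ne_top_iff_integrable ((hwm.mono hm).aestronglyMeasurable.mul hX)
      (Filter.Eventually.of_forall fun x => mul_nonneg (hw0 x).le (hX0 x))).1 ?_
    change ∫⁻ x, ENNReal.ofReal (w x * X x) ∂μ ≠ ∞
    simp only [ENNReal.ofReal_mul (hw0 _).le]
    rw [← lintegral_mul_condLExp hm hwm.measurable.ennreal_ofReal hX.aemeasurable.ennreal_ofReal]
    refine ((lintegral_mono_ae (g := fun _ => 1) ?_).trans_lt (by simp)).ne
    filter_upwards [h] with x hx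
    rw [← hs, ← ENNReal.ofReal_toReal (lt_top_iff_ne_top.1 hx), ← ENNReal.ofReal_mul (hw0 x).le,
      ENNReal.ofReal_le_one, hw, inv_mul_le_iff₀ (hp x)]
    linarith
  have key : IsGenCondExp m μ X fun x => (w x)⁻¹ * (μ[fun x => w x * X x | m]) x :=
    ⟨w, hwm, hw0, fun x => inv_le_one_of_one_le₀ (by simp), hi, Filter.Eventually.of_forall
      fun x => by have := (hw0 x).ne'; simp [this]⟩
  exact key.congr Filter.EventuallyEq.rfl (key.genCondExp_eq hm).symm

end GenCondExp

/-! ### One step of the dynamic programme -/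

section Step

variable {Ω : Type*} {m m₁ m₂ mΩ : MeasurableSpace Ω} {μ : Measure[mΩ] Ω}

lemma IsGenCondExp.trans_of_integrable [IsFiniteMeasure μ] {X Y Z : Ω → ℝ} (hm₁ : m₁ ≤ m₂)
    (hm₂ : m₂ ≤ mΩ) (h : IsGenCondExp m₂ μ X Y) (h' : IsGenCondExp m₁ μ Y Z)
    (hX : Integrable X μ) : IsGenCondExp m₁ μ X Z := by
  have h1 := IsGenCondExp.of_integrable (m := m₁) hX
  exact h1.congr Filter.EventuallyEq.rfl
    ((h.tower hm₁ hm₂ h1).unique (hm₁.trans hm₂) h')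

/-- Completing the square in a nonnegative quadratic polynomial in two variables. -/
lemma complete_square {A α δ B κ C : ℝ} (hδ : 0 ≤ δ)
    (h : ∀ g t : ℝ, 0 ≤ A * g ^ 2 + 2 * g * t * α + t ^ 2 * δ - 2 * B * g - 2 * t * κ + C)
    (g t : ℝ) :
    A * g ^ 2 + 2 * g * t * α + t ^ 2 * δ - 2 * B * g - 2 * t * κ + C =
      (A - α / δ * α) * g ^ 2 - 2 * (B - α / δ * κ) * g + (C - κ / δ * κ)
        + δ * (t - (κ / δ - g * (α / δ))) ^ 2 := by
  rcases hδ.eq_or_lt with h0 | h0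
  -- For `δ = 0` the polynomial is affine in `t`; its nonnegativity at `g = 0` and `g = 1` forces `κ
  -- = 0` and `α = 0`, so division by zero does no harm.
  · subst h0
    have h1 := discrim_le_zero (a := 0) (b := -2 * κ) (c := C) fun t => by
      have := h 0 t; nlinarith
    have h2 := discrim_le_zero (a := 0) (b := 2 * α - 2 * κ) (c := A - 2 * B + C) fun t => by
      have := h 1 t; nlinarith
    simp only [discrim] at h1 h2
    have hκ : κ = 0 := by nlinarith [sq_nonneg κ]
    subst hκ
    have hα : α = 0 := by nlinarith [sq_nonneg α]
    subst hα
    simp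
  · field_simp
    ring

/-- Conditional inequalities hold off a null set depending on `(g, t)`. Rational pairs need only
countably many null sets, and continuity does the rest. -/
lemma nonneg_of_nonneg_rat {A α δ B κ C : ℝ}
    (h : ∀ g t : ℚ, 0 ≤ A * (g : ℝ) ^ 2 + 2 * g * t * α + (t : ℝ) ^ 2 * δ - 2 * B * g - 2 * t * κ + C)
    (g t : ℝ) : 0 ≤ A * g ^ 2 + 2 * g * t * α + t ^ 2 * δ - 2 * B * g - 2 * t * κ + C := by
  have h1 : ∀ (g : ℚ) (t : ℝ),
      0 ≤ A * (g : ℝ) ^ 2 + 2 * g * t * α + t ^ 2 * δ - 2 * B * g - 2 * t * κ + C := fun g t => by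
    refine Rat.isDenseEmbedding_coe_real.dense.induction_on (p := fun t : ℝ =>
      0 ≤ A * (g : ℝ) ^ 2 + 2 * g * t * α + t ^ 2 * δ - 2 * B * g - 2 * t * κ + C) t
      (isClosed_le (by fun_prop) (by fun_prop)) (h g)
  refine Rat.isDenseEmbedding_coe_real.dense.induction_on (p := fun g : ℝ =>
    0 ≤ A * g ^ 2 + 2 * g * t * α + t ^ 2 * δ - 2 * B * g - 2 * t * κ + C) g
    (isClosed_le (by fun_prop) (by fun_prop)) fun g => h1 g t

variable {X s a b c α δ β g ξ A B κ C : Ω → ℝ} {K : ℝ} [IsFiniteMeasure μ]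

lemma IsGenCondExp.quadratic (hm : m ≤ mΩ) (hA : IsGenCondExp m μ a A)
    (hα : IsGenCondExp m μ (fun x => X x * a x) α)
    (hδ : IsGenCondExp m μ (fun x => X x ^ 2 * a x) δ) (hB : IsGenCondExp m μ b B)
    (hκ : IsGenCondExp m μ (fun x => X x * b x) κ) (hC : IsGenCondExp m μ c C)
    (hg : StronglyMeasurable[m] g) (hξ : StronglyMeasurable[m] ξ) :
    IsGenCondExp m μ
      (fun x => a x * (g x + ξ x * X x) ^ 2 - 2 * b x * (g x + ξ x * X x) + c x)
      (fun x => A x * g x ^ 2 + 2 * g x * ξ x * α x + ξ x ^ 2 * δ x - 2 * B x * g x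
        - 2 * ξ x * κ x + C x) := by
  have h2 : StronglyMeasurable[m] fun _ : Ω => (2 : ℝ) := stronglyMeasurable_const
  have e := ((((hA.mul_left hm (hg.pow 2)).add hm (hα.mul_left hm ((h2.mul hg).mul hξ))).add hm
    (hδ.mul_left hm (hξ.pow 2))).sub hm (hB.mul_left hm (h2.mul hg))).sub hm
    (hκ.mul_left hm (h2.mul hξ)) |>.add hm hC
  refine e.congr (Filter.Eventually.of_forall fun x => ?_) (Filter.Eventually.of_forall fun x => ?_)
  · simp only [Pi.mul_apply, Pi.pow_apply]; ring
  · simp only [Pi.mul_apply, Pi.pow_apply]; ring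

/-- One step of the dynamic programme: the cost-to-go `a g² - 2 b g + c`, as a function of the
current wealth `g`, is propagated from time `m₂` to time `m₁ ≤ m₂`. -/
lemma exists_dynamic_programming_step (hm₁ : m₁ ≤ m₂) (hm₂ : m₂ ≤ mΩ)
    (hX : StronglyMeasurable[m₂] X) (hXs : IsGenCondExp m₁ μ (fun x => X x ^ 2) s)
    (ha : StronglyMeasurable[m₂] a) (hb : StronglyMeasurable[m₂] b)
    (ha0 : ∀ᵐ x ∂μ, 0 ≤ a x) (haK : ∀ᵐ x ∂μ, a x ≤ K)
    (hbi : Integrable b μ) (hci : Integrable c μ)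
    (hq : ∀ᵐ x ∂μ, ∀ t : ℝ, 0 ≤ a x * t ^ 2 - 2 * b x * t + c x)
    (hα : IsGenCondExp m₁ μ (fun x => X x * a x) α)
    (hδ : IsGenCondExp m₁ μ (fun x => X x ^ 2 * a x) δ)
    (hαm : StronglyMeasurable[m₁] α) (hδm : StronglyMeasurable[m₁] δ)
    (hβm : StronglyMeasurable[m₁] β) (hβ : β =ᵐ[μ] fun x => α x / δ x) :
    ∃ a' b' c' : Ω → ℝ, StronglyMeasurable[m₁] a' ∧ StronglyMeasurable[m₁] b' ∧
      StronglyMeasurable[m₁] c' ∧ Integrable c' μ ∧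
      (∀ᵐ x ∂μ, 0 ≤ a' x) ∧ (∀ᵐ x ∂μ, a' x ≤ K) ∧
      IsGenCondExp m₁ μ (fun x => (1 - β x * X x) * a x) a' ∧
      IsGenCondExp m₁ μ (fun x => (1 - β x * X x) ^ 2 * a x) a' ∧
      IsGenCondExp m₁ μ (fun x => (1 - β x * X x) * b x) b' ∧
      (∀ᵐ x ∂μ, ∀ t : ℝ, 0 ≤ a' x * t ^ 2 - 2 * b' x * t + c' x) ∧
      (∀ g ξ : Ω → ℝ, StronglyMeasurable[m₁] g → StronglyMeasurable[m₁] ξ →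
        ∫⁻ x, ENNReal.ofReal (a' x * g x ^ 2 - 2 * b' x * g x + c' x) ∂μ ≤
          ∫⁻ x, ENNReal.ofReal
            (a x * (g x + ξ x * X x) ^ 2 - 2 * b x * (g x + ξ x * X x) + c x) ∂μ) ∧
      ∀ g : Ω → ℝ, StronglyMeasurable[m₁] g → ∃ ξ : Ω → ℝ, StronglyMeasurable[m₁] ξ ∧
        ∫⁻ x, ENNReal.ofReal (a' x * g x ^ 2 - 2 * b' x * g x + c' x) ∂μ =
          ∫⁻ x, ENNReal.ofReal
            (a x * (g x + ξ x * X x) ^ 2 - 2 * b x * (g x + ξ x * X x) + c x) ∂μ := by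
  have hm := hm₁.trans hm₂
  have hai : Integrable a μ := by
    refine Integrable.of_bound (ha.mono hm₂).aestronglyMeasurable K ?_
    filter_upwards [ha0, haK] with x h0 h1
    rwa [Real.norm_of_nonneg h0]
  have hA := IsGenCondExp.of_integrable (m := m₁) hai
  have hB := IsGenCondExp.of_integrable (m := m₁) hbi
  have hC := IsGenCondExp.of_integrable (m := m₁) hci
  -- Nonnegativity of the quadratic gives `b² ≤ a c ≤ K c`, hence `|X b| ≤ X² + K c`.
  have hκ : IsGenCondExp m₁ μ (fun x => X x * b x) (genCondExp m₁ μ fun x => X x * b x) := by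
    refine (hXs.add hm (hC.mul_left hm (stronglyMeasurable_const (b := K)))).of_abs_le hm
      ((hX.mul hb).mono hm₂).aestronglyMeasurable ?_
    filter_upwards [ha0, haK, hq] with x h0 h1 h2
    have h3 := discrim_le_zero (a := a x) (b := -2 * b x) (c := c x) fun t => by
      have := h2 t; nlinarith
    have h4 := h2 0
    have h5 : b x ^ 2 ≤ K * c x := by
      simp only [discrim] at h3
      nlinarith
    rw [abs_mul]
    nlinarith [sq_abs (X x), sq_abs (b x), sq_nonneg (|X x| - |b x|)]
  set A := μ[a | m₁] with hAdef
  set B := μ[b | m₁] with hBdef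
  set C := μ[c | m₁] with hCdef
  set κ := genCondExp m₁ μ fun x => X x * b x with hκdef
  have hAm : StronglyMeasurable[m₁] A := stronglyMeasurable_condExp
  have hBm : StronglyMeasurable[m₁] B := stronglyMeasurable_condExp
  have hCm : StronglyMeasurable[m₁] C := stronglyMeasurable_condExp
  have hκm : StronglyMeasurable[m₁] κ := stronglyMeasurable_genCondExp
  have hδ0 : ∀ᵐ x ∂μ, 0 ≤ δ x := hδ.nonneg (by
    filter_upwards [ha0] with x hx using mul_nonneg (sq_nonneg _) hx)
  have hpos : ∀ g ξ : Ω → ℝ,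
      0 ≤ᵐ[μ] fun x => a x * (g x + ξ x * X x) ^ 2 - 2 * b x * (g x + ξ x * X x) + c x := by
    intro g ξ
    filter_upwards [hq] with x hx using hx _
  have hQ : ∀ᵐ x ∂μ, ∀ g t : ℝ, 0 ≤ A x * g ^ 2 + 2 * g * t * α x + t ^ 2 * δ x - 2 * B x * g
      - 2 * t * κ x + C x := by
    have : ∀ᵐ x ∂μ, ∀ g t : ℚ, 0 ≤ A x * (g : ℝ) ^ 2 + 2 * g * t * α x + (t : ℝ) ^ 2 * δ x
        - 2 * B x * g - 2 * t * κ x + C x := by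
      refine ae_all_iff.2 fun g => ae_all_iff.2 fun t => ?_
      exact (hA.quadratic hm hα hδ hB hκ hC (g := fun _ => (g : ℝ)) (ξ := fun _ => (t : ℝ))
        stronglyMeasurable_const stronglyMeasurable_const).nonneg (hpos _ _)
    filter_upwards [this] with x hx using nonneg_of_nonneg_rat hx
  have hsq := hQ.and hδ0
  have key : ∀ᵐ x ∂μ, ∀ g t : ℝ, A x * g ^ 2 + 2 * g * t * α x + t ^ 2 * δ x - 2 * B x * g
      - 2 * t * κ x + C x = (A x - β x * α x) * g ^ 2 - 2 * (B x - β x * κ x) * g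
        + (C x - κ x / δ x * κ x) + δ x * (t - (κ x / δ x - g * β x)) ^ 2 := by
    filter_upwards [hsq, hβ] with x hx hxβ g t
    rw [hxβ]
    exact complete_square hx.2 hx.1 g t
  have hV0 : ∀ᵐ x ∂μ, ∀ t : ℝ, 0 ≤ (A x - β x * α x) * t ^ 2 - 2 * (B x - β x * κ x) * t
        + (C x - κ x / δ x * κ x) := by
    filter_upwards [hQ, key] with x h1 h2 t
    -- At the minimizing control the completed square vanishes.
    have := h1 t (κ x / δ x - t * β x)
    rw [h2] at this
    simpa using this
  have hβα : ∀ᵐ x ∂μ, 0 ≤ β x * α x ∧ 0 ≤ κ x / δ x * κ x ∧ β x * (α x - β x * δ x) = 0 := by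
    filter_upwards [hβ, hδ0] with x h1 h2
    rw [h1, div_mul_eq_mul_div, div_mul_eq_mul_div]
    refine ⟨div_nonneg (mul_self_nonneg _) h2, div_nonneg (mul_self_nonneg _) h2, ?_⟩
    rcases eq_or_ne (δ x) 0 with h | h
    · simp [h]
    · field_simp; simp
  have hC0 : ∀ᵐ x ∂μ, 0 ≤ C x - κ x / δ x * κ x := by
    filter_upwards [hV0] with x hx
    simpa using hx 0
  have hb1 := hB.sub hm (hκ.mul_left hm hβm)
  have ha1 := hA.sub hm (hα.mul_left hm hβm)
  -- Here `(1 - β X)² a` is `(1 - β X) a` minus `β (X a - β X² a)`, and the latter has conditional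
  -- expectation `β (α - β δ) = 0`. So the linear and the squared factor yield the same `a'`.
  have ha2 : IsGenCondExp m₁ μ (fun x => (1 - β x * X x) ^ 2 * a x) fun x => A x - β x * α x := by
    refine (ha1.sub hm ((hα.sub hm (hδ.mul_left hm hβm)).mul_left hm hβm)).congr
      (Filter.Eventually.of_forall fun x => ?_) ?_
    · simp only; ring
    · filter_upwards [hβα] with x hx
      rw [hx.2.2, sub_zero]
  have hcm : StronglyMeasurable[m₁] fun x => C x - κ x / δ x * κ x :=
    (hCm.measurable.sub ((hκm.measurable.div hδm.measurable).mul hκm.measurable)).stronglyMeasurable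
  refine ⟨fun x => A x - β x * α x, fun x => B x - β x * κ x, fun x => C x - κ x / δ x * κ x,
    hAm.sub (hβm.mul hαm), hBm.sub (hβm.mul hκm), hcm, ?_, ?_, ?_, ?_, ha2, ?_, hV0, ?_, ?_⟩
  · refine (integrable_condExp (f := c) (m := m₁) (μ := μ)).mono' (hcm.mono hm).aestronglyMeasurable ?_
    filter_upwards [hC0, hβα] with x h0 h1
    rw [Real.norm_of_nonneg h0]
    linarith [h1.2.1]
  · exact ha2.nonneg (by filter_upwards [ha0] with x hx using mul_nonneg (sq_nonneg _) hx)
  · have hAK : A ≤ᵐ[μ] fun _ => K :=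
      hA.mono hm (IsGenCondExp.of_stronglyMeasurable hm stronglyMeasurable_const) haK
    filter_upwards [hAK, hβα] with x h0 h1
    linarith [h1.1]
  · exact ha1.congr_left fun x => by ring
  · exact hb1.congr_left fun x => by ring
  · intro g ξ hg hξ
    rw [(hA.quadratic hm hα hδ hB hκ hC hg hξ).lintegral_ofReal hm (hpos _ _)]
    refine lintegral_mono_ae ?_
    filter_upwards [key, hδ0] with x h1 h2
    rw [h1]
    exact ENNReal.ofReal_le_ofReal (le_add_of_nonneg_right (mul_nonneg h2 (sq_nonneg _)))
  · intro g hg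
    have hξ : StronglyMeasurable[m₁] fun x => κ x / δ x - g x * β x :=
      ((hκm.measurable.div hδm.measurable).sub (hg.measurable.mul hβm.measurable)).stronglyMeasurable
    refine ⟨_, hξ, ?_⟩
    rw [(hA.quadratic hm hα hδ hB hκ hC hg hξ).lintegral_ofReal hm (hpos _ _)]
    refine lintegral_congr_ae ?_
    filter_upwards [key] with x h1
    rw [h1]
    simp

end Step

/-! ### Backward induction -/

section Backward

variable {Ω : Type*} {mΩ : MeasurableSpace Ω}

/-- `∑_{i=n}^N u_i ∏_{j=n+1}^i v_j`. -/
def tailSum (N : ℕ) (u v : ℕ → Ω → ℝ) (n : ℕ) (x : Ω) : ℝ :=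
  ∑ i ∈ Icc n N, u i x * ∏ j ∈ Ioc n i, v j x

/-- The cost `∑_{i=n}^N ω_i (H_i - g - ∑_{j=n+1}^i ξ_j ΔS_j)²` from time `n` on with wealth `g`. -/
def tailCost (N : ℕ) (S H ω ξ : ℕ → Ω → ℝ) (n : ℕ) (g : Ω → ℝ) (x : Ω) : ℝ :=
  ∑ i ∈ Icc n N, ω i x * (H i x - g x - ∑ j ∈ Ioc n i, ξ j x * incr S j x) ^ 2

variable {N n : ℕ} {u v S H ω β ξ ξ' : ℕ → Ω → ℝ} {g : Ω → ℝ} {ℱ : Filtration ℕ mΩ} {μ : Measure Ω}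

lemma Icc_eq_insert (h : n < N) : Icc n N = insert n (Icc (n + 1) N) := by
  ext i; simp only [mem_Icc, mem_insert]; omega

lemma Ioc_eq_insert {i : ℕ} (h : n + 1 ≤ i) : Ioc n i = insert (n + 1) (Ioc (n + 1) i) := by
  ext j; simp only [mem_Ioc, mem_insert]; omega

lemma tailSum_self (x : Ω) : tailSum N u v N x = u N x := by simp [tailSum]

lemma tailSum_of_lt (h : n < N) (x : Ω) :
    tailSum N u v n x = u n x + v (n + 1) x * tailSum N u v (n + 1) x := by
  rw [tailSum, Icc_eq_insert h, sum_insert (by simp), tailSum, mul_sum]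
  congr 1
  · simp
  · refine sum_congr rfl fun i hi => ?_
    rw [Ioc_eq_insert (mem_Icc.1 hi).1, prod_insert (by simp)]
    ring

lemma tailCost_self (x : Ω) : tailCost N S H ω ξ N g x = ω N x * (H N x - g x) ^ 2 := by
  simp [tailCost]

lemma tailCost_of_lt (h : n < N) (x : Ω) :
    tailCost N S H ω ξ n g x = ω n x * (H n x - g x) ^ 2 +
      tailCost N S H ω ξ (n + 1) (fun y => g y + ξ (n + 1) y * incr S (n + 1) y) x := by
  rw [tailCost, Icc_eq_insert h, sum_insert (by simp), tailCost]
  congr 1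
  · simp
  · refine sum_congr rfl fun i hi => ?_
    rw [Ioc_eq_insert (mem_Icc.1 hi).1, sum_insert (by simp)]
    ring

lemma tailCost_congr (h : ∀ j, n < j → ξ j = ξ' j) :
    tailCost N S H ω ξ n g = tailCost N S H ω ξ' n g := by
  funext x
  refine sum_congr rfl fun i _ => ?_
  rw [sum_congr rfl fun j hj => by rw [h j (mem_Ioc.1 hj).1]]

/-- The standing assumptions on the data of the hedging problem, with `ω` an adapted process with
values in `[0, 1]`. -/
structure HedgingData (N : ℕ) (ℱ : Filtration ℕ mΩ) (μ : Measure Ω) (S H ω β : ℕ → Ω → ℝ) :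
    Prop where
  price : IsPriceProcess N ℱ μ S
  claim_meas : ∀ n ≤ N, StronglyMeasurable[ℱ n] (H n)
  claim_memLp : ∀ n ≤ N, MemLp (H n) 2 μ
  weight_meas : ∀ n ≤ N, StronglyMeasurable[ℱ n] (ω n)
  weight_nonneg : ∀ n ≤ N, ∀ x, 0 ≤ ω n x
  weight_le_one : ∀ n ≤ N, ∀ x, ω n x ≤ 1
  beta_meas : ∀ n ∈ Icc 1 N, StronglyMeasurable[ℱ (n - 1)] (β n)
  beta_eq : ∀ n ∈ Icc 1 N,
    β n =ᵐ[μ] fun x => alphaOf N ℱ μ S ω β n x / deltaOf N ℱ μ S ω β n x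

/-- The factors `1 - β_j ΔS_j`. -/
def factor (S β : ℕ → Ω → ℝ) (j : ℕ) (x : Ω) : ℝ := 1 - β j x * incr S j x

lemma IsPriceProcess.incr_meas (h : IsPriceProcess N ℱ μ S) (hn : n ≤ N) :
    StronglyMeasurable[ℱ n] (incr S n) :=
  (h.adapted n hn).sub ((h.adapted (n - 1) (by omega)).mono (ℱ.mono (by omega)))

namespace HedgingData

variable (h : HedgingData N ℱ μ S H ω β)
include h

lemma factor_meas (hn : n ∈ Icc 1 N) : StronglyMeasurable[ℱ n] (factor S β n) :=
  stronglyMeasurable_const.sub (((h.beta_meas n hn).mono (ℱ.mono (by omega))).mul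
    (h.price.incr_meas (mem_Icc.1 hn).2))

lemma prod_factor_meas {i : ℕ} (hi : i ≤ N) :
    StronglyMeasurable[ℱ i] fun x => ∏ j ∈ Ioc n i, factor S β j x := by
  refine Finset.stronglyMeasurable_fun_prod _ fun j hj => ?_
  rw [mem_Ioc] at hj
  exact (h.factor_meas (mem_Icc.2 (by omega))).mono (ℱ.mono hj.2)

lemma sq_term_le_tailSum {i : ℕ} (hi : i ∈ Icc n N) (x : Ω) :
    ω i x * (∏ j ∈ Ioc n i, factor S β j x) ^ 2 ≤
      tailSum N ω (fun j x => factor S β j x ^ 2) n x := by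
  simp only [tailSum, prod_pow]
  exact single_le_sum (f := fun i => ω i x * (∏ j ∈ Ioc n i, factor S β j x) ^ 2)
    (fun k hk => mul_nonneg (h.weight_nonneg k (mem_Icc.1 hk).2 x) (sq_nonneg _)) hi

lemma tailSum_sq_nonneg (x : Ω) : 0 ≤ tailSum N ω (fun j x => factor S β j x ^ 2) n x :=
  sum_nonneg fun k hk => mul_nonneg (h.weight_nonneg k (mem_Icc.1 hk).2 x)
    (prod_nonneg fun _ _ => sq_nonneg _)

/-- Cauchy–Schwarz with weights `ω i`, whose sum is at most `N + 1`. -/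
lemma sq_tailSum_le (x : Ω) : tailSum N ω (factor S β) n x ^ 2 ≤
    (N + 1 : ℝ) * tailSum N ω (fun j x => factor S β j x ^ 2) n x := by
  have h1 := Finset.sum_sq_le_sum_mul_sum_of_sq_le_mul (Icc n N)
    (r := fun i => ω i x * ∏ j ∈ Ioc n i, factor S β j x) (f := fun i => ω i x)
    (g := fun i => ω i x * ∏ j ∈ Ioc n i, factor S β j x ^ 2)
    (fun i hi => h.weight_nonneg i (mem_Icc.1 hi).2 x)
    (fun i hi => mul_nonneg (h.weight_nonneg i (mem_Icc.1 hi).2 x)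
      (prod_nonneg fun _ _ => sq_nonneg _))
    (fun i _ => le_of_eq (by rw [prod_pow]; ring))
  refine h1.trans (mul_le_mul_of_nonneg_right ?_ (h.tailSum_sq_nonneg x))
  calc ∑ i ∈ Icc n N, ω i x ≤ ∑ i ∈ Icc n N, (1 : ℝ) :=
        sum_le_sum fun i hi => h.weight_le_one i (mem_Icc.1 hi).2 x
    _ ≤ N + 1 := by
        simp only [sum_const, Nat.card_Icc, nsmul_eq_mul, mul_one]
        exact_mod_cast Nat.sub_le _ _

variable [IsFiniteMeasure μ]

/-- With `P` the product and `0 ≤ ω ≤ 1`, one has `ω |P| ≤ 1 + ω P²` and `ω |H P| ≤ H² + ω P²`. -/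
lemma integrable_term (hA : Integrable (tailSum N ω (fun j x => factor S β j x ^ 2) n) μ) {i : ℕ}
    (hi : i ∈ Icc n N) :
    Integrable (fun x => ω i x * ∏ j ∈ Ioc n i, factor S β j x) μ ∧
      Integrable (fun x => ω i x * H i x * ∏ j ∈ Ioc n i, factor S β j x) μ := by
  have hiN := (mem_Icc.1 hi).2
  have hP := (h.prod_factor_meas (n := n) hiN).mono (ℱ.le i)
  have hw := (h.weight_meas i hiN).mono (ℱ.le i)
  have hH := (h.claim_meas i hiN).mono (ℱ.le i)
  refine ⟨((integrable_const 1).add hA).mono' (hw.mul hP).aestronglyMeasurable ?_,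
    ((h.claim_memLp i hiN).integrable_sq.add hA).mono'
      ((hw.mul hH).mul hP).aestronglyMeasurable ?_⟩ <;>
  · refine Filter.Eventually.of_forall fun x => ?_
    have h1 := h.sq_term_le_tailSum hi x
    have h2 := h.weight_nonneg i hiN x
    have h3 := h.weight_le_one i hiN x
    set P := ∏ j ∈ Ioc n i, factor S β j x
    simp only [Real.norm_eq_abs, abs_mul, abs_of_nonneg h2, Pi.add_apply]
    first
    | have h4 : |P| ≤ 1 + P ^ 2 := by rw [← sq_abs P]; nlinarith [sq_nonneg (|P| - 1), abs_nonneg P]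
      nlinarith [mul_le_mul_of_nonneg_left h4 h2]
    | have h4 : |H i x| * |P| ≤ H i x ^ 2 + P ^ 2 := by
        rw [← sq_abs P, ← sq_abs (H i x)]
        nlinarith [sq_nonneg (|P| - |H i x|), sq_nonneg |P|, sq_nonneg |H i x|]
      nlinarith [mul_le_mul_of_nonneg_left h4 h2, sq_nonneg (H i x)]

lemma integrable_tailSum
    (hA : Integrable (tailSum N ω (fun j x => factor S β j x ^ 2) n) μ) :
    Integrable (tailSum N ω (factor S β) n) μ ∧
      Integrable (tailSum N (fun i x => ω i x * H i x) (factor S β) n) μ :=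
  ⟨integrable_finsetSum _ fun _ hi => (h.integrable_term hA hi).1,
    integrable_finsetSum _ fun _ hi => (h.integrable_term hA hi).2⟩

/-- The cost-to-go from time `n` on is a quadratic polynomial `a g² - 2 b g + c` in the wealth. -/
theorem exists_costToGo (hn : n ≤ N) : ∃ (a b c : Ω → ℝ) (K : ℝ),
    StronglyMeasurable[ℱ n] a ∧ StronglyMeasurable[ℱ n] b ∧ StronglyMeasurable[ℱ n] c ∧
    (∀ᵐ x ∂μ, 0 ≤ a x) ∧ (∀ᵐ x ∂μ, a x ≤ K) ∧ Integrable c μ ∧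
    (∀ᵐ x ∂μ, ∀ t : ℝ, 0 ≤ a x * t ^ 2 - 2 * b x * t + c x) ∧
    Integrable (tailSum N ω (fun j x => factor S β j x ^ 2) n) μ ∧
    IsGenCondExp (ℱ n) μ (tailSum N ω (fun j x => factor S β j x ^ 2) n) a ∧
    IsGenCondExp (ℱ n) μ (tailSum N ω (factor S β) n) a ∧
    IsGenCondExp (ℱ n) μ (tailSum N (fun i x => ω i x * H i x) (factor S β) n) b ∧
    ∀ g : Ω → ℝ, StronglyMeasurable[ℱ n] g →
      (∀ ξ ∈ admissible N ℱ, ∫⁻ x, ENNReal.ofReal (a x * g x ^ 2 - 2 * b x * g x + c x) ∂μ ≤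
        ∫⁻ x, ENNReal.ofReal (tailCost N S H ω ξ n g x) ∂μ) ∧
      ∃ ξ ∈ admissible N ℱ, ∫⁻ x, ENNReal.ofReal (a x * g x ^ 2 - 2 * b x * g x + c x) ∂μ =
        ∫⁻ x, ENNReal.ofReal (tailCost N S H ω ξ n g x) ∂μ := by
  induction hn using Nat.decreasingInduction with
  | self =>
    have hw := h.weight_meas N le_rfl
    have hH := h.claim_meas N le_rfl
    have hcm : StronglyMeasurable[ℱ N] fun x => ω N x * H N x ^ 2 := hw.mul (hH.pow 2)
    have hquad : ∀ (x : Ω) (t : ℝ), ω N x * t ^ 2 - 2 * (ω N x * H N x) * t + ω N x * H N x ^ 2 =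
        ω N x * (H N x - t) ^ 2 := fun x t => by ring
    have hs : ∀ (u v : ℕ → Ω → ℝ), tailSum N u v N = u N := fun u v => funext fun x => tailSum_self x
    have hwi : Integrable (ω N) μ := by
      refine Integrable.of_bound (hw.mono (ℱ.le N)).aestronglyMeasurable 1
        (Filter.Eventually.of_forall fun x => ?_)
      rw [Real.norm_of_nonneg (h.weight_nonneg N le_rfl x)]
      exact h.weight_le_one N le_rfl x
    refine ⟨ω N, fun x => ω N x * H N x, fun x => ω N x * H N x ^ 2, 1, hw, hw.mul hH, hcm,
      Filter.Eventually.of_forall (h.weight_nonneg N le_rfl),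
      Filter.Eventually.of_forall (h.weight_le_one N le_rfl), ?_, ?_, ?_, ?_, ?_, ?_, ?_⟩
    · refine (h.claim_memLp N le_rfl).integrable_sq.mono' (hcm.mono (ℱ.le N)).aestronglyMeasurable
        (Filter.Eventually.of_forall fun x => ?_)
      rw [Real.norm_of_nonneg (mul_nonneg (h.weight_nonneg N le_rfl x) (sq_nonneg _))]
      exact mul_le_of_le_one_left (sq_nonneg _) (h.weight_le_one N le_rfl x)
    · refine Filter.Eventually.of_forall fun x t => ?_
      rw [hquad]
      exact mul_nonneg (h.weight_nonneg N le_rfl x) (sq_nonneg _)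
    · rwa [hs]
    · rw [hs]; exact IsGenCondExp.of_stronglyMeasurable (ℱ.le N) hw
    · rw [hs]; exact IsGenCondExp.of_stronglyMeasurable (ℱ.le N) hw
    · rw [hs]; exact IsGenCondExp.of_stronglyMeasurable (ℱ.le N) (hw.mul hH)
    · intro g _
      simp only [hquad, tailCost_self, le_refl, implies_true, true_and, and_true]
      exact ⟨0, fun n _ => stronglyMeasurable_const⟩
  | of_succ n hn ih =>
    obtain ⟨a, b, c, K, ham, hbm, hcm, ha0, haK, hci, hq, hAi, hA, hB, hD, hval⟩ := ih
    have hm₁ : ℱ n ≤ ℱ (n + 1) := ℱ.mono n.le_succ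
    have hm₂ := ℱ.le (n + 1)
    have hm := ℱ.le n
    have hmem : n + 1 ∈ Icc 1 N := mem_Icc.2 ⟨by omega, hn⟩
    set X := incr S (n + 1) with hXdef
    have hXm : StronglyMeasurable[ℱ (n + 1)] X := h.price.incr_meas hn
    have hXs : IsGenCondExp (ℱ n) μ (fun x => X x ^ 2) _ := isGenCondExp_of_condLExp_lt_top hm ((hXm.pow 2).mono hm₂).aestronglyMeasurable
      (fun x => sq_nonneg _) (h.price.locallySquareIntegrable (n + 1) hmem)
    set tA := tailSum N ω (fun j x => factor S β j x ^ 2) (n + 1) with htA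
    set tB := tailSum N ω (factor S β) (n + 1) with htB
    set tD := tailSum N (fun i x => ω i x * H i x) (factor S β) (n + 1) with htD
    have htA0 : ∀ x, 0 ≤ tA x := h.tailSum_sq_nonneg
    obtain ⟨hBi, hDi⟩ := h.integrable_tailSum hAi
    have hX2m : StronglyMeasurable[ℱ (n + 1)] fun x => X x ^ 2 := hXm.pow 2
    -- Conditioning on `ℱ (n + 1)` first replaces the squared tail sum in `deltaOf` by `a`; the
    -- bound `a ≤ K` makes the outer conditional expectation exist.
    have hδ : IsGenCondExp (ℱ n) μ (fun x => X x ^ 2 * a x) (deltaOf N ℱ μ S ω β (n + 1)) := by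
      have h1 : IsGenCondExp (ℱ n) μ (fun x => X x ^ 2 * a x)
          (genCondExp (ℱ n) μ fun x => X x ^ 2 * a x) := by
        refine (hXs.mul_left hm (stronglyMeasurable_const (b := K))).of_abs_le hm
          ((hX2m.mul ham).mono hm₂).aestronglyMeasurable ?_
        filter_upwards [ha0, haK] with x h0 h1
        rw [abs_of_nonneg (mul_nonneg (sq_nonneg _) h0), mul_comm]
        exact mul_le_mul_of_nonneg_right h1 (sq_nonneg _)
      have h2 := (hA.mul_left hm₂ hX2m).trans_of_nonneg hm₁ hm₂ h1
        (Filter.Eventually.of_forall fun x => mul_nonneg (sq_nonneg _) (htA0 x))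
      exact h1.congr Filter.EventuallyEq.rfl (h2.genCondExp_eq hm).symm
    -- The signed tail sum has no sign to exploit, so existence is shown for `X * tB` itself, from
    -- `|X tB| ≤ X² + (N + 1) tA`, and then passed down to `X a` by `tower`.
    have hα : IsGenCondExp (ℱ n) μ (fun x => X x * a x) (alphaOf N ℱ μ S ω β (n + 1)) := by
      have h1 : IsGenCondExp (ℱ n) μ (fun x => X x * tB x) (alphaOf N ℱ μ S ω β (n + 1)) := by
        refine (hXs.add hm ((IsGenCondExp.of_integrable hAi).mul_left hm
          (stronglyMeasurable_const (b := (N + 1 : ℝ))))).of_abs_le hm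
          ((hXm.mono hm₂).aestronglyMeasurable.mul hBi.1) (Filter.Eventually.of_forall fun x => ?_)
        have h3 : tB x ^ 2 ≤ (N + 1 : ℝ) * tA x := h.sq_tailSum_le x
        rw [abs_mul]
        nlinarith [sq_abs (X x), sq_abs (tB x), sq_nonneg (|X x| - |tB x|), sq_nonneg (X x),
          sq_nonneg (tB x)]
      exact (hB.mul_left hm₂ hXm).tower hm₁ hm₂ h1
    have hβm : StronglyMeasurable[ℱ n] (β (n + 1)) := h.beta_meas (n + 1) hmem
    have hbi : Integrable b μ := integrable_condExp.congr (hD.condExp_eq hm₂ hDi)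
    obtain ⟨a', b', c', ham', hbm', hcm', hci', ha0', haK', hB', hA', hD', hq', hlow, hatt⟩ :=
      exists_dynamic_programming_step hm₁ hm₂ hXm hXs ham hbm ha0 haK hbi hci hq hα hδ
        stronglyMeasurable_genCondExp stronglyMeasurable_genCondExp hβm (h.beta_eq (n + 1) hmem)
    have hf := h.factor_meas hmem
    have hf2 : StronglyMeasurable[ℱ (n + 1)] fun x => factor S β (n + 1) x ^ 2 := hf.pow 2
    have hw := h.weight_meas n hn.le
    have hw0 := h.weight_nonneg n hn.le
    have hw1 := h.weight_le_one n hn.le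
    have hH := h.claim_meas n hn.le
    have hwG := IsGenCondExp.of_stronglyMeasurable (μ := μ) hm hw
    have hcwm : StronglyMeasurable[ℱ n] fun x => ω n x * H n x ^ 2 := hw.mul (hH.pow 2)
    have hA1 := (hA.mul_left hm₂ hf2).trans_of_nonneg hm₁ hm₂ hA'
      (Filter.Eventually.of_forall fun x => mul_nonneg (sq_nonneg _) (htA0 x))
    have hA2 : IsGenCondExp (ℱ n) μ (tailSum N ω (fun j x => factor S β j x ^ 2) n)
        fun x => ω n x + a' x := (hwG.add hm hA1).congr_left fun x =>
          (tailSum_of_lt (v := fun j x => factor S β j x ^ 2) hn x).symm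
    have hwa0 : ∀ᵐ x ∂μ, 0 ≤ ω n x + a' x := by
      filter_upwards [ha0'] with x hx using add_nonneg (hw0 x) hx
    have hwaK : ∀ᵐ x ∂μ, ω n x + a' x ≤ 1 + K := by
      filter_upwards [haK'] with x hx using add_le_add (hw1 x) hx
    have hwam : StronglyMeasurable[ℱ n] fun x => ω n x + a' x := hw.add ham'
    -- A nonnegative variable with bounded conditional expectation is integrable.
    have hAi' : Integrable (tailSum N ω (fun j x => factor S β j x ^ 2) n) μ := by
      refine hA2.integrable_of_nonneg hm (Filter.Eventually.of_forall h.tailSum_sq_nonneg)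
        (Integrable.of_bound (hwam.mono hm).aestronglyMeasurable (1 + K) ?_)
      filter_upwards [hwa0, hwaK] with x h0 h1
      rwa [Real.norm_of_nonneg h0]
    obtain ⟨hBi', hDi'⟩ := h.integrable_tailSum hAi'
    -- Covers `u = ω` and `u = ω H` together. The factor times the next tail sum is integrable,
    -- being the current tail sum minus its first term, so conditional expectations compose.
    have hs : ∀ (u : ℕ → Ω → ℝ) (y : Ω → ℝ), Integrable (tailSum N u (factor S β) n) μ →
        Integrable (u n) μ → StronglyMeasurable[ℱ n] (u n) →
        IsGenCondExp (ℱ (n + 1)) μ (fun x => factor S β (n + 1) x * tailSum N u (factor S β) (n + 1) x)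
          y → ∀ z, IsGenCondExp (ℱ n) μ y z →
        IsGenCondExp (ℱ n) μ (tailSum N u (factor S β) n) fun x => u n x + z x := by
      intro u y hi hu hum hy z hz
      have h1 := hy.trans_of_integrable hm₁ hm₂ hz ((hi.sub hu).congr
        (Filter.Eventually.of_forall fun x => by
          simp only [Pi.sub_apply]; rw [tailSum_of_lt hn x]; ring))
      exact ((IsGenCondExp.of_stronglyMeasurable hm hum).add hm h1).congr_left
        fun x => (tailSum_of_lt hn x).symm
    have hnn : n ∈ Icc n N := mem_Icc.2 ⟨le_rfl, hn.le⟩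
    have hwi : Integrable (ω n) μ := by simpa using (h.integrable_term hAi' hnn).1
    have hwHi : Integrable (fun x => ω n x * H n x) μ := by
      simpa using (h.integrable_term hAi' hnn).2
    have hquad : ∀ x t, (ω n x + a' x) * t ^ 2 - 2 * (ω n x * H n x + b' x) * t
        + (ω n x * H n x ^ 2 + c' x) =
        ω n x * (H n x - t) ^ 2 + (a' x * t ^ 2 - 2 * b' x * t + c' x) := fun x t => by ring
    have hcost : ∀ x (ξ : ℕ → Ω → ℝ) g, 0 ≤ tailCost N S H ω ξ (n + 1) g x := fun x ξ g =>
      sum_nonneg fun k hk => mul_nonneg (h.weight_nonneg k (mem_Icc.1 hk).2 x) (sq_nonneg _)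
    refine ⟨fun x => ω n x + a' x, fun x => ω n x * H n x + b' x, fun x => ω n x * H n x ^ 2 + c' x,
      1 + K, hwam, (hw.mul hH).add hbm', hcwm.add hcm', hwa0, hwaK, ?_, ?_, hAi', hA2,
      hs ω _ hBi' hwi hw (hB.mul_left hm₂ hf) a' hB',
      hs (fun i x => ω i x * H i x) _ hDi' hwHi (hw.mul hH) (hD.mul_left hm₂ hf) b' hD', ?_⟩
    · refine Integrable.add ((h.claim_memLp n hn.le).integrable_sq.mono'
        (hcwm.mono hm).aestronglyMeasurable (Filter.Eventually.of_forall fun x => ?_)) hci'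
      rw [Real.norm_of_nonneg (mul_nonneg (hw0 x) (sq_nonneg _))]
      exact mul_le_of_le_one_left (sq_nonneg _) (hw1 x)
    · filter_upwards [hq'] with x hx t
      rw [hquad]
      exact add_nonneg (mul_nonneg (hw0 x) (sq_nonneg _)) (hx t)
    · intro g hg
      have hrun : StronglyMeasurable fun x => ω n x * (H n x - g x) ^ 2 :=
        (hw.mul ((hH.sub hg).pow 2)).mono hm
      have hrun' := hrun.measurable.ennreal_ofReal
      have hleft : ∫⁻ x, ENNReal.ofReal ((ω n x + a' x) * g x ^ 2
            - 2 * (ω n x * H n x + b' x) * g x + (ω n x * H n x ^ 2 + c' x)) ∂μ =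
          ∫⁻ x, ENNReal.ofReal (ω n x * (H n x - g x) ^ 2) ∂μ +
            ∫⁻ x, ENNReal.ofReal (a' x * g x ^ 2 - 2 * b' x * g x + c' x) ∂μ := by
        rw [← lintegral_add_left hrun']
        refine lintegral_congr_ae ?_
        filter_upwards [hq'] with x hx
        rw [hquad, ENNReal.ofReal_add (mul_nonneg (hw0 x) (sq_nonneg _)) (hx _)]
      have hright : ∀ ξ : ℕ → Ω → ℝ, ∫⁻ x, ENNReal.ofReal (tailCost N S H ω ξ n g x) ∂μ =
          ∫⁻ x, ENNReal.ofReal (ω n x * (H n x - g x) ^ 2) ∂μ +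
            ∫⁻ x, ENNReal.ofReal (tailCost N S H ω ξ (n + 1)
              (fun y => g y + ξ (n + 1) y * incr S (n + 1) y) x) ∂μ := by
        intro ξ
        rw [← lintegral_add_left hrun']
        refine lintegral_congr fun x => ?_
        rw [tailCost_of_lt hn, ENNReal.ofReal_add (mul_nonneg (hw0 x) (sq_nonneg _)) (hcost x _ _)]
      simp only [hleft, hright]
      have hwealth : ∀ η : Ω → ℝ, StronglyMeasurable[ℱ n] η →
          StronglyMeasurable[ℱ (n + 1)] fun y => g y + η y * incr S (n + 1) y := fun η hη =>
        (hg.mono hm₁).add ((hη.mono hm₁).mul hXm)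
      refine ⟨fun ξ hξ => ?_, ?_⟩
      · have hη : StronglyMeasurable[ℱ n] (ξ (n + 1)) := hξ (n + 1) hmem
        gcongr 1
        exact (hlow g (ξ (n + 1)) hg hη).trans ((hval _ (hwealth _ hη)).1 ξ hξ)
      · obtain ⟨η, hη, hηe⟩ := hatt g hg
        obtain ⟨ξ, hξ, hξe⟩ := (hval _ (hwealth η hη)).2
        -- Gluing: the cost from `n + 1` on depends only on controls with index beyond `n + 1`, so
        -- overwriting that entry keeps the later strategy optimal.
        refine ⟨Function.update ξ (n + 1) η, fun k hk => ?_, ?_⟩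
        · rcases eq_or_ne k (n + 1) with rfl | hne
          · simpa using hη
          · rw [Function.update_of_ne hne]; exact hξ k hk
        · rw [hηe, hξe, Function.update_self, tailCost_congr (ξ := Function.update ξ (n + 1) η)
            (ξ' := ξ) fun j hj => Function.update_of_ne (by omega) _ _]

end HedgingData

end Backward

/-! ### The pricing problem -/

section Pricing

variable {Ω : Type*} {mΩ : MeasurableSpace Ω} {N n : ℕ} {S H ω β ξ : ℕ → Ω → ℝ}
  {ℱ : Filtration ℕ mΩ} {μ : Measure Ω} {τ : Ω → ℕ}

lemma Icc_one_eq_Ioc_zero (n : ℕ) : Icc 1 n = Ioc 0 n := by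
  ext i; simp only [mem_Icc, mem_Ioc]; omega

/-- For `A = 0` nonnegativity forces `B = 0`; the quadratic is then constant and the value `0 / 0 =
0` is a minimizer. -/
lemma quadratic_min {A B C : ℝ} (hA : 0 ≤ A) (h : ∀ t : ℝ, 0 ≤ A * t ^ 2 - 2 * B * t + C) (t : ℝ) :
    A * (B / A) ^ 2 - 2 * B * (B / A) + C ≤ A * t ^ 2 - 2 * B * t + C := by
  rcases hA.eq_or_lt with h0 | h0
  · subst h0
    have h1 := discrim_le_zero (a := 0) (b := -2 * B) (c := C) fun t => by
      have := h t; nlinarith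
    have hB : B = 0 := by
      simp only [discrim] at h1
      nlinarith [sq_nonneg B]
    simp [hB]
  · have h1 : A * (B / A) ^ 2 - 2 * B * (B / A) + C = C - B ^ 2 / A := by field_simp; ring
    have h2 : A * t ^ 2 - 2 * B * t + C = C - B ^ 2 / A + A * (t - B / A) ^ 2 := by
      field_simp; ring
    rw [h1, h2]
    exact le_add_of_nonneg_right (mul_nonneg hA (sq_nonneg _))

/-- Replacing the random horizon by its conditional distribution. -/
lemma hedgingError_eq [IsFiniteMeasure μ] (hS : IsPriceProcess N ℱ μ S)
    (hH : ∀ n ≤ N, StronglyMeasurable[ℱ n] (H n)) (hτ : Measurable τ) (hτN : ∀ x, τ x ≤ N)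
    (hω : ∀ n ≤ N, ω n =ᵐ[μ] μ⟦τ ⁻¹' {n} | ℱ n⟧) (hω0 : ∀ n ≤ N, ∀ x, 0 ≤ ω n x)
    (hωm : ∀ n ≤ N, StronglyMeasurable[ℱ n] (ω n)) (c : ℝ) (hξ : ξ ∈ admissible N ℱ) :
    hedgingError μ S H τ c ξ = ∫⁻ x, ENNReal.ofReal (tailCost N S H ω ξ 0 (fun _ => c) x) ∂μ := by
  set f : ℕ → Ω → ℝ := fun i x => (H i x - c - gain S ξ i x) ^ 2 with hf
  have hf0 : ∀ i x, 0 ≤ f i x := fun i x => sq_nonneg _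
  have hfm : ∀ i ≤ N, StronglyMeasurable[ℱ i] (f i) := by
    intro i hi
    have hG : StronglyMeasurable[ℱ i] (gain S ξ i) := by
      refine Finset.stronglyMeasurable_fun_sum _ fun j hj => ?_
      rw [mem_Icc] at hj
      exact ((hξ j (mem_Icc.2 ⟨hj.1, hj.2.trans hi⟩)).mono (ℱ.mono (by omega))).mul
        ((hS.incr_meas (hj.2.trans hi)).mono (ℱ.mono hj.2))
    exact (((hH i hi).sub stronglyMeasurable_const).sub hG).pow 2
  set I : ℕ → Ω → ℝ := fun i => (τ ⁻¹' {i}).indicator fun _ => 1 with hI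
  have hI0 : ∀ i x, 0 ≤ I i x := fun i x => Set.indicator_nonneg (fun _ _ => zero_le_one) x
  have hIm : ∀ i, MeasurableSet (τ ⁻¹' {i}) := fun i => hτ (measurableSet_singleton i)
  have hleft : ∀ x, ENNReal.ofReal ((H (τ x) x - c - gain S ξ (τ x) x) ^ 2) =
      ∑ i ∈ Icc 0 N, ENNReal.ofReal (f i x * I i x) := by
    intro x
    rw [sum_eq_single_of_mem (τ x) (mem_Icc.2 ⟨Nat.zero_le _, hτN x⟩)]
    · simp [hf, hI]
    · intro i _ hi
      simp [hI, hi.symm]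
  have hright : ∀ x, ENNReal.ofReal (tailCost N S H ω ξ 0 (fun _ => c) x) =
      ∑ i ∈ Icc 0 N, ENNReal.ofReal (f i x * ω i x) := by
    intro x
    rw [← ENNReal.ofReal_sum_of_nonneg fun i hi => mul_nonneg (hf0 i x) (hω0 i (mem_Icc.1 hi).2 x)]
    simp only [tailCost, hf, gain, Icc_one_eq_Ioc_zero, mul_comm]
  rw [hedgingError]
  simp only [hleft, hright]
  rw [lintegral_finsetSum' _ fun i hi => ?_, lintegral_finsetSum' _ fun i hi => ?_]
  · refine sum_congr rfl fun i hi => ?_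
    have hiN := (mem_Icc.1 hi).2
    -- The squared error `f i` is `ℱ i`-measurable, so it can be pulled out whether integrable or
    -- not.
    have h1 : IsGenCondExp (ℱ i) μ (I i) (ω i) :=
      (IsGenCondExp.of_integrable ((integrable_const (1 : ℝ)).indicator (hIm i))).congr
        Filter.EventuallyEq.rfl (hω i hiN).symm
    exact (h1.mul_left (ℱ.le i) (hfm i hiN)).lintegral_ofReal (ℱ.le i)
      (Filter.Eventually.of_forall fun x => mul_nonneg (hf0 i x) (hI0 i x))
  · have hiN := (mem_Icc.1 hi).2
    exact (((hfm i hiN).mul (hωm i hiN)).mono (ℱ.le i)).measurable.ennreal_ofReal.aemeasurable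
  · have hiN := (mem_Icc.1 hi).2
    exact (((hfm i hiN).mono (ℱ.le i)).measurable.mul
      (measurable_const.indicator (hIm i))).ennreal_ofReal.aemeasurable

/-- The backward induction needs weights in `[0, 1]` everywhere. Changing `ω` on null sets alters
`α` and `δ` only on null sets, so the `β` built from `ω` still serves for `ω'`. -/
lemma hedgingData_of_ae_eq {ω' : ℕ → Ω → ℝ} (hS : IsPriceProcess N ℱ μ S)
    (hH : ∀ n ≤ N, StronglyMeasurable[ℱ n] (H n)) (hH2 : ∀ n ≤ N, MemLp (H n) 2 μ)
    (hωm : ∀ n ≤ N, StronglyMeasurable[ℱ n] (ω' n)) (hω0 : ∀ n ≤ N, ∀ x, 0 ≤ ω' n x)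
    (hω1 : ∀ n ≤ N, ∀ x, ω' n x ≤ 1) (hω : ∀ n ≤ N, ω n =ᵐ[μ] ω' n) :
    HedgingData N ℱ μ S H ω' (beta N ℱ μ S ω) := by
  have hall : ∀ᵐ x ∂μ, ∀ n ≤ N, ω n x = ω' n x := by
    rw [ae_all_iff]; intro n
    by_cases hn : n ≤ N
    · filter_upwards [hω n hn] with x hx _ using hx
    · exact Filter.Eventually.of_forall fun x h => absurd h hn
  refine ⟨hS, hH, hH2, hωm, hω0, hω1, fun n hn => ?_, fun n hn => ?_⟩
  · rw [beta_eq N ℱ μ S ω n hn]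
    exact (stronglyMeasurable_genCondExp.measurable.div
      stronglyMeasurable_genCondExp.measurable).stronglyMeasurable
  · have h1 : alphaOf N ℱ μ S ω (beta N ℱ μ S ω) n =ᵐ[μ] alphaOf N ℱ μ S ω' (beta N ℱ μ S ω) n := by
      refine genCondExp_congr_ae ?_
      filter_upwards [hall] with x hx
      rw [sum_congr rfl fun i hi => by rw [hx i (mem_Icc.1 hi).2]]
    have h2 : deltaOf N ℱ μ S ω (beta N ℱ μ S ω) n =ᵐ[μ] deltaOf N ℱ μ S ω' (beta N ℱ μ S ω) n := by
      refine genCondExp_congr_ae ?_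
      filter_upwards [hall] with x hx
      rw [sum_congr rfl fun i hi => by rw [hx i (mem_Icc.1 hi).2]]
    rw [beta_eq N ℱ μ S ω n hn]
    filter_upwards [h1, h2] with x e1 e2
    rw [Pi.div_apply, e1, e2]

/-- The minimal error is a quadratic polynomial in the initial capital. -/
theorem HedgingData.exists_quadratic_value [IsFiniteMeasure μ] (h : HedgingData N ℱ μ S H ω β) :
    ∃ C : ℝ, (∀ n ≤ N, Integrable (fun x => ω n x * ∏ j ∈ Ioc 0 n, factor S β j x) μ ∧
        Integrable (fun x => ω n x * H n x * ∏ j ∈ Ioc 0 n, factor S β j x) μ) ∧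
      0 ≤ ∫ x, tailSum N ω (factor S β) 0 x ∂μ ∧
      ∀ t : ℝ, 0 ≤ (∫ x, tailSum N ω (factor S β) 0 x ∂μ) * t ^ 2
          - 2 * (∫ x, tailSum N (fun i x => ω i x * H i x) (factor S β) 0 x ∂μ) * t + C ∧
        (∀ ξ ∈ admissible N ℱ, ENNReal.ofReal ((∫ x, tailSum N ω (factor S β) 0 x ∂μ) * t ^ 2
          - 2 * (∫ x, tailSum N (fun i x => ω i x * H i x) (factor S β) 0 x ∂μ) * t + C) ≤
          ∫⁻ x, ENNReal.ofReal (tailCost N S H ω ξ 0 (fun _ => t) x) ∂μ) ∧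
        ∃ ξ ∈ admissible N ℱ, ENNReal.ofReal ((∫ x, tailSum N ω (factor S β) 0 x ∂μ) * t ^ 2
          - 2 * (∫ x, tailSum N (fun i x => ω i x * H i x) (factor S β) 0 x ∂μ) * t + C) =
          ∫⁻ x, ENNReal.ofReal (tailCost N S H ω ξ 0 (fun _ => t) x) ∂μ := by
  obtain ⟨a, b, c, K, ham, hbm, hcm, ha0, haK, hci, hq, hAi, hA, hB, hD, hval⟩ :=
    h.exists_costToGo (Nat.zero_le N)
  have hm := ℱ.le 0
  obtain ⟨hBi, hDi⟩ := h.integrable_tailSum hAi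
  have ea := hB.condExp_eq hm hBi
  have eb := hD.condExp_eq hm hDi
  have hai : Integrable a μ := integrable_condExp.congr ea
  have hbi : Integrable b μ := integrable_condExp.congr eb
  rw [← integral_condExp hm (f := tailSum N ω (factor S β) 0), integral_congr_ae ea,
    ← integral_condExp hm (f := tailSum N (fun i x => ω i x * H i x) (factor S β) 0),
    integral_congr_ae eb]
  have hint : ∀ t : ℝ, Integrable (fun x => a x * t ^ 2 - 2 * b x * t + c x) μ ∧
      ∫ x, a x * t ^ 2 - 2 * b x * t + c x ∂μ =
        (∫ x, a x ∂μ) * t ^ 2 - 2 * (∫ x, b x ∂μ) * t + ∫ x, c x ∂μ := by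
    intro t
    have i1 : Integrable (fun x => a x * t ^ 2) μ := hai.mul_const _
    have i2 : Integrable (fun x => 2 * b x * t) μ := (hbi.const_mul 2).mul_const t
    refine ⟨(i1.sub i2).add hci, ?_⟩
    have i3 : Integrable (fun x => a x * t ^ 2 - 2 * b x * t) μ := i1.sub i2
    rw [integral_add i3 hci, integral_sub i1 i2, integral_mul_const, integral_mul_const,
      integral_const_mul]
  have hqt : ∀ t : ℝ, 0 ≤ᵐ[μ] fun x => a x * t ^ 2 - 2 * b x * t + c x := fun t => by
    filter_upwards [hq] with x hx using hx t
  refine ⟨∫ x, c x ∂μ, fun n hn => h.integrable_term hAi (mem_Icc.2 ⟨Nat.zero_le _, hn⟩),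
    integral_nonneg_of_ae ha0, fun t => ?_⟩
  rw [← (hint t).2, ofReal_integral_eq_lintegral_ofReal (hint t).1 (hqt t)]
  exact ⟨integral_nonneg_of_ae (hqt t), hval (fun _ => t) stronglyMeasurable_const⟩

/-! ### Independent horizon and martingale prices -/

/-- Backward induction: once the later `β_j` vanish, all products are one and the weights are
constants, so `α_n` is a constant times `E[ΔS_n | F_{n-1}] = 0`. -/
lemma beta_ae_eq_zero [IsFiniteMeasure μ] {p : ℕ → ℝ} (hω : ∀ n ≤ N, ω n =ᵐ[μ] fun _ => p n)
    (hM : Martingale (fun n => S (min n N)) ℱ μ) (hn : n ∈ Icc 1 N) :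
    beta N ℱ μ S ω n =ᵐ[μ] 0 := by
  suffices ∀ k, ∀ n ∈ Icc 1 N, N - n < k → beta N ℱ μ S ω n =ᵐ[μ] 0 from
    this (N - n + 1) n hn (Nat.lt_succ_self _)
  intro k
  induction k with
  | zero => intro n _ h; omega
  | succ k ih =>
    intro n hn hk
    have hn' := mem_Icc.1 hn
    have hall : ∀ᵐ x ∂μ, ∀ i ≤ N, ω i x = p i := by
      rw [ae_all_iff]; intro i
      by_cases hi : i ≤ N
      · filter_upwards [hω i hi] with x hx _ using hx
      · exact Filter.Eventually.of_forall fun x h => absurd h hi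
    have hbeta : ∀ᵐ x ∂μ, ∀ j ∈ Ioc n N, beta N ℱ μ S ω j x = 0 := by
      rw [ae_all_iff]; intro j
      by_cases hj : j ∈ Ioc n N
      · have hj' := mem_Ioc.1 hj
        filter_upwards [ih j (mem_Icc.2 (by omega)) (by omega)] with x hx _ using hx
      · exact Filter.Eventually.of_forall fun x h => absurd h hj
    have hSi : ∀ i ≤ N, Integrable (S i) μ := fun i hi => by
      simpa [min_eq_left hi] using hM.integrable i
    have hincr : μ[incr S n | ℱ (n - 1)] =ᵐ[μ] 0 := by
      have h1 : μ[S n | ℱ (n - 1)] =ᵐ[μ] S (n - 1) := by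
        simpa [min_eq_left hn'.2, min_eq_left (show n - 1 ≤ N by omega)] using
          hM.2 (n - 1) n (by omega)
      have h2 : μ[S (n - 1) | ℱ (n - 1)] =ᵐ[μ] S (n - 1) := by
        simpa [min_eq_left (show n - 1 ≤ N by omega)] using hM.2 (n - 1) (n - 1) le_rfl
      filter_upwards [condExp_sub (hSi n hn'.2) (hSi (n - 1) (by omega)) (ℱ (n - 1)), h1, h2]
        with x e1 e2 e3
      change (μ[S n - S (n - 1) | ℱ (n - 1)]) x = 0
      rw [e1, Pi.sub_apply, e2, e3, sub_self]
    have hincri : Integrable (incr S n) μ := (hSi n hn'.2).sub (hSi (n - 1) (by omega))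
    have hm := ℱ.le (n - 1)
    have hα : alphaOf N ℱ μ S ω (beta N ℱ μ S ω) n =ᵐ[μ] 0 := by
      have h1 := ((IsGenCondExp.of_integrable (m := ℱ (n - 1)) hincri).mul_left hm
        (stronglyMeasurable_const (b := ∑ i ∈ Icc n N, p i))).genCondExp_eq hm
      refine Filter.EventuallyEq.trans (genCondExp_congr_ae ?_) (h1.trans ?_)
      · filter_upwards [hall, hbeta] with x h2 h3
        rw [mul_comm]
        congr 1
        refine sum_congr rfl fun i hi => ?_
        have hi' := mem_Icc.1 hi
        rw [h2 i hi'.2, prod_eq_one fun j hj => ?_, mul_one]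
        have hj' := mem_Ioc.1 hj
        rw [h3 j (mem_Ioc.2 (by omega))]
        ring
      · filter_upwards [hincr] with x hx
        simp [hx]
    rw [beta_eq N ℱ μ S ω n hn]
    filter_upwards [hα] with x hx
    simp [hx]

lemma sum_measureReal_eq_one [IsProbabilityMeasure μ] (hτ : Measurable τ) (hτN : ∀ x, τ x ≤ N) :
    ∑ n ∈ range (N + 1), μ.real {x | τ x = n} = 1 := by
  rw [← measureReal_biUnion_finset]
  · have : (⋃ n ∈ range (N + 1), {x | τ x = n}) = Set.univ := by
      ext x
      simpa using Nat.lt_succ_of_le (hτN x)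
    rw [this, probReal_univ]
  · intro i _ j _ hij
    refine Set.disjoint_left.2 fun x hx hx' => hij (hx.symm.trans hx')
  · exact fun n _ => hτ (measurableSet_singleton n)

/-- For an independent horizon and a martingale the optimal price is the averaged expected payoff. -/
theorem cStar_of_indep_of_martingale [IsProbabilityMeasure μ] (hτ : Measurable τ)
    (hτN : ∀ x, τ x ≤ N) (hω : ∀ n ≤ N, ω n =ᵐ[μ] μ⟦τ ⁻¹' {n} | ℱ n⟧)
    (hind : Indep (MeasurableSpace.comap τ ⊤) (ℱ N) μ)
    (hM : Martingale (fun n => S (min n N)) ℱ μ) :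
    cStar N ℱ μ S ω H = ∑ n ∈ range (N + 1), (∫ x, H n x ∂μ) * μ.real {x | τ x = n} := by
  have hp : ∀ n ≤ N, ω n =ᵐ[μ] fun _ => μ.real {x | τ x = n} := by
    intro n hn
    have hset : MeasurableSet[MeasurableSpace.comap τ ⊤] (τ ⁻¹' {n}) := ⟨{n}, trivial, rfl⟩
    have h1 := condExp_indep_eq (μ := μ) hτ.comap_le (ℱ.le n)
      (stronglyMeasurable_const.indicator (s := τ ⁻¹' {n}) (f := fun _ => (1 : ℝ)) hset)
      (indep_of_indep_of_le_right hind (ℱ.mono hn))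
    refine (hω n hn).trans (h1.trans (Filter.Eventually.of_forall fun x => ?_))
    simp only
    rw [integral_indicator_const _ (hτ (measurableSet_singleton n))]
    simp [Set.preimage]
  have hbeta : ∀ᵐ x ∂μ, ∀ j ∈ Icc 1 N, beta N ℱ μ S ω j x = 0 := by
    rw [ae_all_iff]; intro j
    by_cases hj : j ∈ Icc 1 N
    · filter_upwards [beta_ae_eq_zero hp hM hj] with x hx _ using hx
    · exact Filter.Eventually.of_forall fun x h => absurd h hj
  have hZ : ∀ n ∈ range (N + 1), Zproc N ℱ μ S ω n =ᵐ[μ] fun _ => μ.real {x | τ x = n} := by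
    intro n hn
    have hn' : n ≤ N := Nat.lt_succ_iff.1 (mem_range.1 hn)
    filter_upwards [hp n hn', hbeta] with x h1 h2
    rw [Zproc, h1, prod_eq_one fun j hj => ?_, mul_one]
    have hj' := mem_Icc.1 hj
    rw [h2 j (mem_Icc.2 (by omega))]
    ring
  have hden : ∑ n ∈ range (N + 1), ∫ x, Zproc N ℱ μ S ω n x ∂μ = 1 := by
    rw [← sum_measureReal_eq_one (μ := μ) hτ hτN]
    refine sum_congr rfl fun n hn => ?_
    rw [integral_congr_ae (hZ n hn)]
    simp
  rw [cStar, hden, div_one]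
  refine sum_congr rfl fun n hn => ?_
  rw [mul_comm, ← integral_const_mul]
  refine integral_congr_ae ?_
  filter_upwards [hZ n hn] with x hx
  rw [hx]

end Pricing

end QuadHedge

end

/-! ### Assembly of the main theorem -/

theorem mainTheorem5 {Ω : Type*} {mΩ : MeasurableSpace Ω} (μ : Measure Ω) [IsProbabilityMeasure μ]
    (N : ℕ) (ℱ : Filtration ℕ mΩ) (S H ω : ℕ → Ω → ℝ) (τ : Ω → ℕ)
    (hS : QuadHedge.IsPriceProcess N ℱ μ S)
    (hH : ∀ n ≤ N, StronglyMeasurable[ℱ n] (H n)) (hH2 : ∀ n ≤ N, MemLp (H n) 2 μ)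
    (hτ : Measurable τ) (hτN : ∀ x, τ x ≤ N)
    (hω : ∀ n ≤ N, ω n =ᵐ[μ] μ⟦τ ⁻¹' {n} | ℱ n⟧) :
    -- the expectations in the formula for `c⋆` exist
    (∀ n ≤ N, Integrable (QuadHedge.Zproc N ℱ μ S ω n) μ ∧
      Integrable (fun x => QuadHedge.Zproc N ℱ μ S ω n x * H n x) μ) ∧
    -- the inner minimum over strategies is attained for every initial capital
    (∀ c : ℝ, ∃ ξ ∈ QuadHedge.admissible N ℱ,
      IsMinOn (QuadHedge.hedgingError μ S H τ c) (QuadHedge.admissible N ℱ) ξ) ∧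
    -- `c⋆` minimizes the value function
    IsMinOn (fun c : ℝ => ⨅ ξ ∈ QuadHedge.admissible N ℱ, QuadHedge.hedgingError μ S H τ c ξ)
      Set.univ (QuadHedge.cStar N ℱ μ S ω H) ∧
    -- `τ` independent of the market information, `S_0, …, S_N` a martingale
    (Indep (MeasurableSpace.comap τ ⊤) (ℱ N) μ → Martingale (fun n => S (min n N)) ℱ μ →
      QuadHedge.cStar N ℱ μ S ω H =
        ∑ n ∈ range (N + 1), (∫ x, H n x ∂μ) * μ.real {x | τ x = n}) := by
  -- A version of the conditional probabilities truncated to `[0, 1]` at every point.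
  set ω' : ℕ → Ω → ℝ := fun n x => min 1 (max 0 ((μ⟦τ ⁻¹' {n} | ℱ n⟧) x)) with hω'
  have hωm : ∀ n ≤ N, StronglyMeasurable[ℱ n] (ω' n) := fun n _ =>
    (measurable_const.min
      (measurable_const.max stronglyMeasurable_condExp.measurable)).stronglyMeasurable
  have hω0 : ∀ n ≤ N, ∀ x, 0 ≤ ω' n x := fun n _ x => le_min zero_le_one (le_max_left _ _)
  have hω1 : ∀ n ≤ N, ∀ x, ω' n x ≤ 1 := fun n _ x => min_le_left _ _
  have hver : ∀ n, ω' n =ᵐ[μ] μ⟦τ ⁻¹' {n} | ℱ n⟧ := by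
    intro n
    have hind : Integrable ((τ ⁻¹' {n}).indicator fun _ => (1 : ℝ)) μ :=
      (integrable_const 1).indicator (hτ (measurableSet_singleton n))
    have h0 : 0 ≤ᵐ[μ] μ⟦τ ⁻¹' {n} | ℱ n⟧ := condExp_nonneg
      (Filter.Eventually.of_forall fun x => Set.indicator_nonneg (fun _ _ => zero_le_one) x)
    have h1 : μ⟦τ ⁻¹' {n} | ℱ n⟧ ≤ᵐ[μ] μ[fun _ => (1 : ℝ) | ℱ n] :=
      condExp_mono hind (integrable_const 1) (Filter.Eventually.of_forall fun x =>
        Set.indicator_le_self' (fun _ _ => zero_le_one) x)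
    rw [condExp_const (ℱ.le n)] at h1
    filter_upwards [h0, h1] with x e0 e1
    rw [Pi.zero_apply] at e0
    simp only [hω']
    rw [max_eq_right e0, min_eq_right e1]
  have hωω' : ∀ n ≤ N, ω n =ᵐ[μ] ω' n := fun n hn => (hω n hn).trans (hver n).symm
  have hdata := QuadHedge.hedgingData_of_ae_eq hS hH hH2 hωm hω0 hω1 hωω'
  have herr := fun c ξ hξ => QuadHedge.hedgingError_eq (ξ := ξ) hS hH hτ hτN
    (fun n _ => hver n) hω0 hωm c hξ
  obtain ⟨C, hint, hA0, hval⟩ := hdata.exists_quadratic_value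
  have hZ : ∀ n ≤ N, (fun x => ω' n x * ∏ j ∈ Ioc 0 n,
      QuadHedge.factor S (QuadHedge.beta N ℱ μ S ω) j x) =ᵐ[μ] QuadHedge.Zproc N ℱ μ S ω n := by
    intro n hn
    filter_upwards [hωω' n hn] with x hx
    rw [QuadHedge.Zproc, hx, QuadHedge.Icc_one_eq_Ioc_zero]
    rfl
  have hZH : ∀ n ≤ N, (fun x => ω' n x * H n x * ∏ j ∈ Ioc 0 n,
      QuadHedge.factor S (QuadHedge.beta N ℱ μ S ω) j x) =ᵐ[μ]
      fun x => QuadHedge.Zproc N ℱ μ S ω n x * H n x := by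
    intro n hn
    filter_upwards [hZ n hn] with x hx
    rw [← hx]
    ring
  have hrange : range (N + 1) = Icc 0 N := Nat.range_succ_eq_Icc_zero N
  have hA : ∫ x, QuadHedge.tailSum N ω' (QuadHedge.factor S (QuadHedge.beta N ℱ μ S ω)) 0 x ∂μ =
      ∑ n ∈ range (N + 1), ∫ x, QuadHedge.Zproc N ℱ μ S ω n x ∂μ := by
    rw [hrange]
    refine (integral_finsetSum _ fun n hn => (hint n (mem_Icc.1 hn).2).1).trans
      (sum_congr rfl fun n hn => integral_congr_ae (hZ n (mem_Icc.1 hn).2))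
  have hB : ∫ x, QuadHedge.tailSum N (fun i x => ω' i x * H i x)
      (QuadHedge.factor S (QuadHedge.beta N ℱ μ S ω)) 0 x ∂μ =
      ∑ n ∈ range (N + 1), ∫ x, QuadHedge.Zproc N ℱ μ S ω n x * H n x ∂μ := by
    rw [hrange]
    refine (integral_finsetSum _ fun n hn => (hint n (mem_Icc.1 hn).2).2).trans
      (sum_congr rfl fun n hn => integral_congr_ae (hZH n (mem_Icc.1 hn).2))
  rw [hA] at hA0 hval
  rw [hB] at hval
  refine ⟨fun n hn => ⟨(hint n hn).1.congr (hZ n hn), (hint n hn).2.congr (hZH n hn)⟩,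
    fun c => ?_, ?_, QuadHedge.cStar_of_indep_of_martingale hτ hτN hω⟩
  · obtain ⟨-, hlow, ξ, hξ, he⟩ := hval c
    refine ⟨ξ, hξ, fun η hη => ?_⟩
    rw [Set.mem_ofPred_eq, herr c ξ hξ, herr c η hη, ← he]
    exact hlow η hη
  -- Attainment turns the infimum into the explicit quadratic, which `c⋆` minimizes as its vertex.
  · have hW : ∀ c : ℝ, ⨅ ξ ∈ QuadHedge.admissible N ℱ, QuadHedge.hedgingError μ S H τ c ξ =
        ENNReal.ofReal ((∑ n ∈ range (N + 1), ∫ x, QuadHedge.Zproc N ℱ μ S ω n x ∂μ) * c ^ 2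
          - 2 * (∑ n ∈ range (N + 1), ∫ x, QuadHedge.Zproc N ℱ μ S ω n x * H n x ∂μ) * c + C) := by
      intro c
      obtain ⟨-, hlow, ξ, hξ, he⟩ := hval c
      refine le_antisymm (iInf₂_le_of_le ξ hξ (by rw [herr c ξ hξ, he])) (le_iInf₂ fun η hη => ?_)
      rw [herr c η hη]
      exact hlow η hη
    intro c _
    simp only [Set.mem_ofPred_eq, hW]
    exact ENNReal.ofReal_le_ofReal (QuadHedge.quadratic_min hA0 (fun t => (hval t).1) c)
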